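/- Let $d\in\mathbb N$ and let $\{X_{nj}: n\in\mathbb N,\ j\in\mathbb Z^d\}$ be real random variables with mean zero on a probability space $(\Omega,\mathcal F,P)$ such that, for each $n$, the variables $X_{nj}$, $j\in\mathbb Z^d$, are independent. Assume that for each $n$ there is $H_n>0$ such that, for every $j$, $\mathbb E e^{zX_{nj}}$ exists for all complex $z$ with $|z|<H_n$ and has there an analytic logarithm $L_{nj}(z)=\log \mathbb E e^{zX_{nj}}$, normalized by $L_{nj}(0)=0$. Let $S_n=\sum_{j\in\mathbb Z^d}X_{nj}$, which is assumed to be well defined as the limit in probability, as $m\to\infty$, of the sums of $X_{nj}$ over $j\in[-m,m]^d\cap\mathbb Z^d$. Put $B_n=\sum_{j\in\mathbb Z^d}\operatorname{Var}(X_{nj})$, assumed finite for each $n$, and $F_n(x)=P(S_n<x\sqrt{B_n})$. Suppose that there are constants $c_{nj}\ge 0$ with $|L_{nj}(z)|\le c_{nj}$ for all $|z|<H_n$, all $n\in\mathbb N$ and all $j\in\mathbb Z^d$, that $B_nH_n^2\to\infty$ as $n\to\infty$, and that $C_n:=\sum_{j\in\mathbb Z^d}c_{nj}$ is finite for each $n$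 with $C_n=O(B_nH_n^2)$ as $n\to\infty$. Then for every real sequence $x=x_n$ with $x_n\to\infty$ and $x_n=o(H_n\sqrt{B_n})$ as $n\to\infty$, and for every constant $c>0$, $$\frac{F_n\left(x_n+\frac{c}{x_n}\right)-F_n(x_n)}{1-F_n(x_n)}\longrightarrow 1-e^{-c}\qquad(n\to\infty).$$ -/

import Mathlib

open MeasureTheory ProbabilityTheory Filter Topology Asymptotics

namespace CramerField

noncomputable section

variable {Ω : Type*} [MeasurableSpace Ω] {d : ℕ}

/-- `L` is the cumulant generating function of `Y` on the complex disc `{|z| < r}`: the complex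
moment generating function `E exp (z Y)` exists there, and `L` is the analytic branch of its
logarithm with `L 0 = 0`. -/
structure IsCGFOnDisc (Y : Ω → ℝ) (μ : Measure Ω) (r : ℝ) (L : ℂ → ℂ) : Prop where
  integrable : ∀ z : ℂ, ‖z‖ < r → Integrable (fun ω => Complex.exp (z * (Y ω : ℂ))) μ
  analytic : AnalyticOnNhd ℂ L (Metric.ball 0 r)
  map_zero : L 0 = 0
  exp_eq : ∀ z : ℂ, ‖z‖ < r → Complex.exp (L z) = complexMGF Y μ z

/-- The cube `[-m, m]^d ∩ ℤ^d`. -/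
def cube (d m : ℕ) : Finset (Fin d → ℤ) :=
  Finset.Icc (fun _ => -(m : ℤ)) (fun _ => (m : ℤ))

/-- The sum of the field `Y` over the cube `[-m, m]^d ∩ ℤ^d`. -/
def cubeSum (Y : (Fin d → ℤ) → Ω → ℝ) (m : ℕ) (ω : Ω) : ℝ :=
  ∑ j ∈ cube d m, Y j ω

/-- `T` is the sum over all of `ℤ^d` of the field `Y`: the limit of the sums over cubes,
in probability. -/
def IsFieldSum (Y : (Fin d → ℤ) → Ω → ℝ) (μ : Measure Ω) (T : Ω → ℝ) : Prop :=
  TendstoInMeasure μ (cubeSum Y) atTop T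

/-- The sum over `ℤ^d` of the variances of the field `Y`. -/
def totalVar (Y : (Fin d → ℤ) → Ω → ℝ) (μ : Measure Ω) : ℝ :=
  ∑' j, Var[Y j; μ]

/-- The left-continuous distribution function `x ↦ P (T < x √b)`. -/
def normCDF (T : Ω → ℝ) (μ : Measure Ω) (b x : ℝ) : ℝ :=
  μ.real {ω | T ω < x * √b}

end

end CramerField

/-! The argument is Cramér's exponential tilting followed by a local limit theorem. Let W be the sum
divided by √B. Taylor expansion of the cumulant generating functions, summed against the bounds c,
gives E exp(zW) = exp(z²/2 + R(z)) with R = O(|z|³/D) on a disc of radius D of order H√B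
(`IsFieldSum.hasCubicRemainder`). For x = o(D) there is a saddle point h with h + R'(h) = x and h/x
→ 1 (`exists_saddle`).

Tilt by exp(hW) and let Q be the law of h(W - x). The tail P(W ≥ x + b) is then a constant
independent of b times the integral of exp(-y) over [hb, ∞) against Q (`expTail_tiltedLaw`). The
saddle equation removes the linear term from the exponent of the characteristic function of Q, which
at t/h is nearly exp(-t²/2) for |t| ≤ Ah, for every A (`charFun_tiltedLaw_eq`, `norm_sub_sub_le`).
Hence hQ tends vaguely to a multiple of Lebesgue measure. With b = a/x, so hb → a, the ratio of
tails tends to ∫_a^∞ exp(-y) dy / ∫_0^∞ exp(-y) dy = exp(-a).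

Vague convergence is reduced to Lévy's continuity theorem by weighting with a positive integrable
kernel whose Fourier transform has compact support: the weighted, normalised measures are
probability measures whose characteristic functions at a point only involve Q's on a bounded
interval (`tendsto_integral_div`). As exp(-y) on a half-line is dominated by the kernel, the tails
converge too (`tendsto_expTail`). -/

namespace CramerField

/-! ### A positive kernel with compactly supported Fourier transform -/

/-- The triangular window on `[-1, 1]`. -/
noncomputable def tent (s : ℝ) : ℝ := max 0 (1 - |s|)

lemma tent_nonneg (s : ℝ) : 0 ≤ tent s := le_max_left _ _

lemma tent_le_one (s : ℝ) : tent s ≤ 1 :=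
  max_le zero_le_one (by linarith [abs_nonneg s])

lemma tent_of_one_le {s : ℝ} (hs : 1 ≤ |s|) : tent s = 0 := max_eq_left (by linarith)

@[fun_prop]
lemma continuous_tent : Continuous tent := by unfold tent; fun_prop

lemma integrable_of_eq_zero_of_one_le {E : Type*} [NormedAddCommGroup E] {f : ℝ → E}
    (hf : Continuous f) (h0 : ∀ s, 1 ≤ |s| → f s = 0) : Integrable f := by
  refine hf.integrable_of_hasCompactSupport ?_
  refine HasCompactSupport.intro (isCompact_Icc (a := (-1 : ℝ)) (b := 1)) fun s hs => h0 s ?_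
  by_contra h
  exact hs (abs_le.1 (not_le.1 h).le)

/-- The Fourier transform of the triangular window. -/
noncomputable def fejer (y : ℝ) : ℝ := ∫ s, tent s * Real.cos (s * y)

lemma integrable_tent_mul_cos (y : ℝ) : Integrable fun s => tent s * Real.cos (s * y) :=
  integrable_of_eq_zero_of_one_le (by fun_prop) fun s hs => by simp [tent_of_one_le hs]

lemma fejer_eq_intervalIntegral (y : ℝ) :
    fejer y = ∫ s in (-1 : ℝ)..1, tent s * Real.cos (s * y) := by
  rw [intervalIntegral.integral_of_le (by norm_num), ← integral_Icc_eq_integral_Ioc, fejer]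
  refine (setIntegral_eq_integral_of_forall_compl_eq_zero fun s hs => ?_).symm
  rw [tent_of_one_le, zero_mul]
  by_contra h
  exact hs (abs_le.1 (not_le.1 h).le)

/-- Explicit antiderivatives on each half of the support. Keeping the factor y² on the left avoids a
case split at y = 0; the sign and decay of `fejer` are read off from this identity. -/
lemma sq_mul_fejer (y : ℝ) : y ^ 2 * fejer y = 2 * (1 - Real.cos y) := by
  have hc : ∀ a b : ℝ, IntervalIntegrable (fun s => tent s * Real.cos (s * y)) volume a b :=
    fun a b => (by fun_prop : Continuous _).intervalIntegrable a b
  rw [fejer_eq_intervalIntegral,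
    ← intervalIntegral.integral_add_adjacent_intervals (hc (-1) 0) (hc 0 1), mul_add,
    ← intervalIntegral.integral_const_mul, ← intervalIntegral.integral_const_mul]
  have hl : ∫ s in (-1 : ℝ)..0, y ^ 2 * (tent s * Real.cos (s * y)) = 1 - Real.cos y := by
    rw [intervalIntegral.integral_eq_sub_of_hasDerivAt
      (f := fun s => (1 + s) * y * Real.sin (s * y) + Real.cos (s * y))]
    · simp
    · intro s hs
      rw [Set.uIcc_of_le (by norm_num)] at hs
      have ht : tent s = 1 + s := by
        rw [tent, abs_of_nonpos hs.2, sub_neg_eq_add, max_eq_right]; linarith [hs.1]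
      have h1 := (hasDerivAt_id s).mul_const y
      have h := ((((hasDerivAt_id s).const_add 1).mul_const y).mul h1.sin).add h1.cos
      refine h.congr_deriv ?_
      simp only [id, ht]
      ring
    · exact ((hc _ _).const_mul _)
  have hr : ∫ s in (0 : ℝ)..1, y ^ 2 * (tent s * Real.cos (s * y)) = 1 - Real.cos y := by
    rw [intervalIntegral.integral_eq_sub_of_hasDerivAt
      (f := fun s => (1 - s) * y * Real.sin (s * y) - Real.cos (s * y))]
    · simp; ring
    · intro s hs
      rw [Set.uIcc_of_le (by norm_num)] at hs
      have ht : tent s = 1 - s := by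
        rw [tent, abs_of_nonneg hs.1, max_eq_right]; linarith [hs.2]
      have h1 := (hasDerivAt_id s).mul_const y
      have h := ((((hasDerivAt_id s).const_sub 1).mul_const y).mul h1.sin).sub h1.cos
      refine h.congr_deriv ?_
      simp only [id, ht]
      ring
    · exact ((hc _ _).const_mul _)
  rw [hl, hr]
  ring

lemma fejer_nonneg (y : ℝ) : 0 ≤ fejer y := by
  rcases eq_or_ne y 0 with rfl | hy
  · exact integral_nonneg fun s => by simpa using tent_nonneg s
  · have h := sq_mul_fejer y
    have : 0 < y ^ 2 := by positivity
    by_contra hneg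
    nlinarith [Real.cos_le_one y]

lemma fejer_le_two (y : ℝ) : fejer y ≤ 2 := by
  rw [fejer_eq_intervalIntegral]
  refine (le_abs_self _).trans ?_
  have h := intervalIntegral.norm_integral_le_of_norm_le_const (a := (-1 : ℝ)) (b := 1) (C := 1)
    (f := fun s => tent s * Real.cos (s * y)) fun s _ => by
      rw [norm_mul, Real.norm_eq_abs, Real.norm_eq_abs, abs_of_nonneg (tent_nonneg s)]
      exact mul_le_one₀ (tent_le_one s) (abs_nonneg _) (Real.abs_cos_le_one _)
  rw [Real.norm_eq_abs] at h
  norm_num at h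
  exact h

lemma fejer_le (y : ℝ) : fejer y ≤ 6 * (1 + y ^ 2)⁻¹ := by
  rw [← div_eq_mul_inv, le_div_iff₀ (by positivity)]
  nlinarith [fejer_le_two y, sq_mul_fejer y, Real.neg_one_le_cos y]

lemma le_fejer (y q : ℝ) (hq : 0 < q) (hy : |y| ≤ q) : 2 * (1 - Real.cos y) / q ^ 2 ≤ fejer y := by
  rw [div_le_iff₀ (by positivity), ← sq_mul_fejer, mul_comm]
  exact mul_le_mul_of_nonneg_left (sq_le_sq.2 (by rwa [abs_of_pos hq])) (fejer_nonneg y)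

lemma continuous_fourier_of_eq_zero {T : ℝ → ℝ} (hT : Continuous T)
    (h0 : ∀ s, 1 ≤ |s| → T s = 0) : Continuous fun y : ℝ => ∫ s, T s * Real.cos (s * y) := by
  refine continuous_of_dominated (bound := fun s => ‖T s‖) ?_ ?_ ?_ ?_
  · exact fun y => (by fun_prop : Continuous _).aestronglyMeasurable
  · refine fun y => .of_forall fun s => ?_
    rw [norm_mul]
    exact mul_le_of_le_one_right (norm_nonneg _) (Real.abs_cos_le_one _)
  · exact (integrable_of_eq_zero_of_one_le hT h0).norm
  · exact .of_forall fun s => by fun_prop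

/-- The triangular window modulated so that its Fourier transform is everywhere positive. -/
noncomputable def window (s : ℝ) : ℝ := tent s * (1 + Real.cos (Real.pi * s))

/-- The Fourier transform of `window`. -/
noncomputable def kernel (y : ℝ) : ℝ := ∫ s, window s * Real.cos (s * y)

@[fun_prop]
lemma continuous_window : Continuous window := by unfold window; fun_prop

lemma window_of_one_le {s : ℝ} (hs : 1 ≤ |s|) : window s = 0 := by
  simp [window, tent_of_one_le hs]

lemma window_zero : window 0 = 2 := by norm_num [window, tent]

lemma window_neg (s : ℝ) : window (-s) = window s := by simp [window, tent]

@[fun_prop]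
lemma continuous_kernel : Continuous kernel :=
  continuous_fourier_of_eq_zero continuous_window fun _ => window_of_one_le

lemma kernel_eq (y : ℝ) :
    kernel y = fejer y + (fejer (y + Real.pi) + fejer (y - Real.pi)) / 2 := by
  rw [kernel, fejer, fejer, fejer, ← integral_add (integrable_tent_mul_cos _)
    (integrable_tent_mul_cos _), ← integral_div, ← integral_add
    (g := fun s => (tent s * Real.cos (s * (y + Real.pi)) + tent s * Real.cos (s * (y - Real.pi))) / 2)
    (integrable_tent_mul_cos _)
    (((integrable_tent_mul_cos _).add (integrable_tent_mul_cos _)).div_const _)]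
  congr 1 with s
  rw [window, mul_add s, mul_sub s, Real.cos_add, Real.cos_sub, mul_comm Real.pi]
  ring

/-- The Fejér kernel vanishes at the nonzero multiples of 2π. Shifting by ±π turns 1 - cos y into 1
+ cos y, so over a common denominator the cosines cancel and the numerator is the constant 4. -/
lemma le_kernel (y : ℝ) : 4 / (|y| + Real.pi) ^ 2 ≤ kernel y := by
  have hpi := Real.pi_pos
  have hq : 0 < |y| + Real.pi := by positivity
  have h0 := le_fejer y _ hq (by linarith)
  have h1 := le_fejer (y + Real.pi) _ hq
    ((abs_add_le _ _).trans (by rw [abs_of_pos hpi]))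
  have h2 := le_fejer (y - Real.pi) _ hq
    ((abs_sub _ _).trans (by rw [abs_of_pos hpi]))
  rw [Real.cos_add_pi] at h1
  rw [Real.cos_sub_pi] at h2
  rw [kernel_eq]
  calc 4 / (|y| + Real.pi) ^ 2 = 2 * (1 - Real.cos y) / (|y| + Real.pi) ^ 2 +
      (2 * (1 - -Real.cos y) / (|y| + Real.pi) ^ 2 +
        2 * (1 - -Real.cos y) / (|y| + Real.pi) ^ 2) / 2 := by ring
    _ ≤ _ := by linarith

lemma kernel_pos (y : ℝ) : 0 < kernel y :=
  lt_of_lt_of_le (by have := Real.pi_pos; positivity) (le_kernel y)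

lemma integrable_fejer : Integrable fejer := by
  refine (integrable_inv_one_add_sq.const_mul 6).mono'
    (continuous_fourier_of_eq_zero continuous_tent
      fun _ => tent_of_one_le).aestronglyMeasurable (.of_forall fun y => ?_)
  rw [Real.norm_eq_abs, abs_of_nonneg (fejer_nonneg y)]
  exact fejer_le y

lemma integrable_kernel : Integrable kernel := by
  have h := integrable_fejer.add
    (((integrable_fejer.comp_add_right Real.pi).add
      (integrable_fejer.comp_sub_right Real.pi)).div_const 2)
  refine h.congr (.of_forall fun y => ?_)
  simp [kernel_eq]

lemma kernel_le (y : ℝ) : kernel y ≤ 4 := by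
  rw [kernel_eq]
  linarith [fejer_le_two y, fejer_le_two (y + Real.pi), fejer_le_two (y - Real.pi)]

open Complex in
lemma integral_window_mul_exp (y : ℝ) :
    ∫ s : ℝ, (window s : ℂ) * exp (s * y * I) = (kernel y : ℂ) := by
  have hi : Integrable fun s : ℝ => (window s : ℂ) * exp (s * y * I) :=
    integrable_of_eq_zero_of_one_le (by fun_prop) fun s hs => by simp [window_of_one_le hs]
  have hsymm : ∫ s : ℝ, (window s : ℂ) * exp (s * y * I)
      = ∫ s : ℝ, (window s : ℂ) * exp (-(s * y * I)) := by
    rw [← integral_neg_eq_self]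
    congr 1 with s
    rw [window_neg]
    push_cast
    ring_nf
  have hi' : Integrable fun s : ℝ => (window s : ℂ) * exp (-(s * y * I)) :=
    integrable_of_eq_zero_of_one_le (by fun_prop) fun s hs => by simp [window_of_one_le hs]
  -- The window is even, so averaging the integral with its reflection turns the exponential into a
  -- cosine.
  have h2 : 2 * ∫ s : ℝ, (window s : ℂ) * exp (s * y * I) = 2 * (kernel y : ℂ) := by
    rw [two_mul]
    nth_rewrite 2 [hsymm]
    rw [← integral_add hi hi', kernel, ← integral_complex_ofReal, ← integral_const_mul]
    congr 1 with s
    push_cast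
    rw [Complex.cos, neg_mul]
    ring
  exact mul_left_cancel₀ two_ne_zero h2

open Complex Real.Angle FourierTransform in
-- Fourier inversion for the window; the substitution y = -2πv converts between the two
-- normalisations of the transform.
lemma integral_kernel_mul_exp (θ : ℝ) :
    ∫ y : ℝ, (kernel y : ℂ) * exp (θ * y * I) = 2 * Real.pi * window θ := by
  set f : ℝ → ℂ := fun s => (window s : ℂ) with hf
  have hfc : Continuous f := by fun_prop
  have hfi : Integrable f :=
    integrable_of_eq_zero_of_one_le hfc fun s hs => by simp [hf, window_of_one_le hs]
  have hF : ∀ v, 𝓕 f v = (kernel (v * (-2 * Real.pi)) : ℂ) := by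
    intro v
    rw [Real.fourier_eq', ← integral_window_mul_exp]
    congr 1 with s
    simp only [RCLike.inner_apply, conj_trivial, smul_eq_mul, hf]
    rw [mul_comm]
    congr 2
    push_cast
    ring
  have hFi : Integrable (𝓕 f) := by
    have := (integrable_kernel.comp_mul_right' (R := (-2 * Real.pi))
      (by simp [Real.pi_ne_zero])).ofReal (𝕜 := ℂ)
    exact this.congr (.of_forall fun v => (hF v).symm)
  have hinv := congrFun (hfc.fourierInv_fourier_eq hfi hFi) (-θ)
  rw [Real.fourierInv_eq'] at hinv
  have hg : ∀ v : ℝ, exp (↑(2 * Real.pi * inner ℝ v (-θ)) * I) • 𝓕 f v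
      = (fun y : ℝ => (kernel y : ℂ) * exp (θ * y * I)) (v * (-2 * Real.pi)) := by
    intro v
    simp only [RCLike.inner_apply, conj_trivial, smul_eq_mul, hF]
    rw [mul_comm]
    congr 2
    push_cast
    ring
  rw [integral_congr_ae (.of_forall hg), Measure.integral_comp_mul_right
    (fun y : ℝ => (kernel y : ℂ) * exp (θ * y * I)), hf] at hinv
  simp only [window_neg] at hinv
  rw [← hinv]
  have : |(-2 * Real.pi)⁻¹| = (2 * Real.pi)⁻¹ := by
    rw [abs_inv, abs_mul, abs_neg, abs_two, abs_of_pos Real.pi_pos]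
  rw [this, Complex.real_smul]
  push_cast
  rw [mul_inv_cancel_left₀]
  simp [Real.pi_ne_zero]

/-! ### Vague convergence to Lebesgue measure -/

/-- The characteristic function of `Q n` is, at the scale `1 / h n`, that of a centred normal
variable of standard deviation `h n`, with a quadratically bounded error `E n`
in the exponent. -/
def IsGaussianScaling (Q : ℕ → Measure ℝ) (h : ℕ → ℝ) (E : ℕ → ℝ → ℂ) : Prop :=
  ∀ A > 0, ∀ ε > 0, ∀ᶠ n in atTop, ∀ t : ℝ, |t| ≤ A * h n →
    ‖E n t‖ ≤ ε * t ^ 2 ∧ charFun (Q n) (t / h n) = Complex.exp (-t ^ 2 / 2 + E n t)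

section Vague

variable {Q : ℕ → Measure ℝ} [∀ n, IsProbabilityMeasure (Q n)] {h : ℕ → ℝ}
  {E : ℕ → ℝ → ℂ}

open Complex in
lemma integral_fourier_eq_integral_charFun (P : Measure ℝ) [IsProbabilityMeasure P] {T : ℝ → ℂ}
    (hT : Continuous T) (hi : Integrable T) :
    ∫ y, (∫ s : ℝ, T s * exp (s * y * I)) ∂P = ∫ s, T s * charFun P s := by
  rw [integral_integral_swap]
  · congr 1 with s
    rw [integral_const_mul, charFun_apply_real]
  · refine (hi.comp_snd P).mono (by fun_prop) (.of_forall fun z => ?_)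
    simp only [Function.uncurry, norm_mul]
    rw [show (z.2 : ℂ) * z.1 * I = ((z.2 * z.1 : ℝ) : ℂ) * I by push_cast; ring,
      norm_exp_ofReal_mul_I, mul_one]

open Complex in
-- By Fubini the integral is that of T against the characteristic function, and s = t/h absorbs the
-- factor h. The support of T confines t to |t| ≤ bh, where the Gaussian approximation holds, and
-- dominated convergence applies.
lemma IsGaussianScaling.tendsto_fourier (hQ : IsGaussianScaling Q h E) (hh : Tendsto h atTop atTop)
    {T : ℝ → ℂ} (hT : Continuous T) {b : ℝ} (hb : 0 < b) (hsupp : ∀ s, b ≤ |s| → T s = 0) :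
    Tendsto (fun n => (h n : ℂ) * ∫ y, (∫ s : ℝ, T s * exp (s * y * I)) ∂(Q n)) atTop
      (𝓝 (√(2 * Real.pi) * T 0)) := by
  have hcs : HasCompactSupport T := by
    refine HasCompactSupport.intro (isCompact_Icc (a := -b) (b := b)) fun s hs => hsupp s ?_
    by_contra hlt
    exact hs (abs_le.1 (not_le.1 hlt).le)
  have hi : Integrable T := hT.integrable_of_hasCompactSupport hcs
  obtain ⟨M, hM⟩ := hT.bounded_above_of_compact_support hcs
  have hM0 : 0 ≤ M := (norm_nonneg _).trans (hM 0)
  have hscale : ∀ᶠ n in atTop, (h n : ℂ) * ∫ y, (∫ s : ℝ, T s * exp (s * y * I)) ∂(Q n)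
      = ∫ t : ℝ, T (t / h n) * charFun (Q n) (t / h n) := by
    filter_upwards [hh.eventually_gt_atTop 0] with n hn
    rw [integral_fourier_eq_integral_charFun _ hT hi,
      Measure.integral_comp_div (fun s => T s * charFun (Q n) s), abs_of_pos hn, real_smul]
  have hlim : (√(2 * Real.pi) * T 0 : ℂ) = ∫ t : ℝ, T 0 * exp (-t ^ 2 / 2) := by
    rw [integral_const_mul, mul_comm]
    congr 1
    have := integral_gaussian (1 / 2)
    rw [show √(2 * Real.pi) = ∫ x : ℝ, Real.exp (-(1 / 2) * x ^ 2) by rw [this]; congr 1; ring,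
      ← integral_complex_ofReal]
    congr 1 with t
    push_cast
    ring_nf
  rw [hlim, tendsto_congr' hscale]
  refine tendsto_integral_filter_of_dominated_convergence
    (fun t => M * Real.exp (-(1 / 4) * t ^ 2)) ?_ ?_ ?_ ?_
  · exact .of_forall fun n => by
      have := (measurable_charFun (μ := Q n))
      exact (by fun_prop : Measurable _).aestronglyMeasurable
  -- Error t²/4 against the main term -t²/2 leaves the integrable majorant exp(-t²/4).
  · filter_upwards [hQ b hb (1 / 4) (by norm_num), hh.eventually_gt_atTop 0] with n hn hpos
    refine .of_forall fun t => ?_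
    rcases le_total b |t / h n| with ht | ht
    · rw [hsupp _ ht, zero_mul, norm_zero]
      positivity
    · rw [abs_div, abs_of_pos hpos, div_le_iff₀ hpos] at ht
      obtain ⟨hE, hc⟩ := hn t ht
      rw [norm_mul, hc, norm_exp]
      refine mul_le_mul (hM _) (Real.exp_le_exp.2 ?_) (Real.exp_nonneg _) hM0
      have h1 : (-(t : ℂ) ^ 2 / 2 + E n t).re = -t ^ 2 / 2 + (E n t).re := by
        rw [add_re, show (-(t : ℂ) ^ 2 / 2) = ((-t ^ 2 / 2 : ℝ) : ℂ) by push_cast; ring, ofReal_re]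
      rw [h1]
      linarith [re_le_norm (E n t)]
  · exact (integrable_exp_neg_mul_sq (by norm_num)).const_mul _
  · refine .of_forall fun t => Tendsto.mul ?_ ?_
    · have : Tendsto (fun n => t / h n) atTop (𝓝 0) := hh.const_div_atTop t
      exact (hT.tendsto 0).comp this
    · have hE : Tendsto (fun n => E n t) atTop (𝓝 0) := by
        rw [Metric.tendsto_nhds]
        intro ε hε
        filter_upwards [hQ 1 one_pos (ε / (2 * (t ^ 2 + 1))) (by positivity),
          hh.eventually_ge_atTop |t|] with n hn ht
        rw [dist_zero_right]
        refine ((hn t (by simpa using ht)).1).trans_lt ?_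
        rw [div_mul_eq_mul_div, div_lt_iff₀ (by positivity)]
        nlinarith [sq_nonneg t]
      have hexp : Tendsto (fun n => exp (-t ^ 2 / 2 + E n t)) atTop (𝓝 (exp (-t ^ 2 / 2))) := by
        have := (continuous_exp.tendsto _).comp (hE.const_add (-(t : ℂ) ^ 2 / 2))
        rwa [add_zero] at this
      refine hexp.congr' ?_
      filter_upwards [hQ 1 one_pos 1 one_pos, hh.eventually_ge_atTop |t|] with n hn ht
      exact (hn t (by simpa using ht)).2.symm

end Vague

section Vague

variable {Q : ℕ → Measure ℝ} [∀ n, IsProbabilityMeasure (Q n)] {h : ℕ → ℝ}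
  {E : ℕ → ℝ → ℂ}

lemma integrable_kernel_of_isFiniteMeasure (P : Measure ℝ) [IsFiniteMeasure P] :
    Integrable kernel P := by
  refine (integrable_const (4 : ℝ)).mono' (by fun_prop) (.of_forall fun y => ?_)
  rw [Real.norm_eq_abs, abs_of_pos (kernel_pos y)]
  exact kernel_le y

/-- The probability measure with density proportional to `kernel` with respect to `P`. -/
noncomputable def kernelMeasure (P : Measure ℝ) : Measure ℝ := P.tilted fun y => Real.log (kernel y)

lemma isProbabilityMeasure_kernelMeasure {P : Measure ℝ} [NeZero P] (hP : Integrable kernel P) :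
    IsProbabilityMeasure (kernelMeasure P) :=
  isProbabilityMeasure_tilted (by simpa only [Real.exp_log (kernel_pos _)] using hP)

instance (P : Measure ℝ) [IsProbabilityMeasure P] : IsProbabilityMeasure (kernelMeasure P) :=
  isProbabilityMeasure_kernelMeasure (integrable_kernel_of_isFiniteMeasure P)

instance : IsProbabilityMeasure (kernelMeasure (volume : Measure ℝ)) :=
  isProbabilityMeasure_kernelMeasure integrable_kernel

lemma integral_kernelMeasure (P : Measure ℝ) (f : ℝ → ℝ) :
    ∫ y, f y ∂kernelMeasure P = (∫ y, f y * kernel y ∂P) / ∫ y, kernel y ∂P := by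
  rw [kernelMeasure, integral_tilted, ← integral_div]
  simp only [Real.exp_log (kernel_pos _), smul_eq_mul]
  congr 1 with y
  ring

lemma charFun_kernelMeasure (P : Measure ℝ) (θ : ℝ) :
    charFun (kernelMeasure P) θ
      = (∫ y, (kernel y : ℂ) * Complex.exp (θ * y * Complex.I) ∂P) / (∫ y, kernel y ∂P : ℝ) := by
  rw [charFun_apply_real, kernelMeasure, integral_tilted, ← integral_div]
  simp only [Real.exp_log (kernel_pos _), Complex.real_smul]
  congr 1 with y
  push_cast
  ring

lemma integral_kernel : ∫ y, kernel y = 4 * Real.pi := by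
  have h0 := integral_kernel_mul_exp 0
  simp only [Complex.ofReal_zero, zero_mul, Complex.exp_zero, mul_one, window_zero] at h0
  rw [integral_complex_ofReal] at h0
  have h1 : ((∫ y, kernel y : ℝ) : ℂ) = ((4 * Real.pi : ℝ) : ℂ) := by
    rw [h0]; push_cast; ring
  exact_mod_cast h1

lemma charFun_kernelMeasure_volume (θ : ℝ) :
    charFun (kernelMeasure (volume : Measure ℝ)) θ = window θ / 2 := by
  rw [charFun_kernelMeasure, integral_kernel_mul_exp, integral_kernel]
  have : (Real.pi : ℂ) ≠ 0 := by simp [Real.pi_ne_zero]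
  push_cast
  field_simp
  ring

open Complex in
-- Multiplying the kernel by exp(iθy) translates the window by θ, which keeps its support compact.
lemma IsGaussianScaling.tendsto_kernel_mul_exp (hQ : IsGaussianScaling Q h E)
    (hh : Tendsto h atTop atTop) (θ : ℝ) :
    Tendsto (fun n => (h n : ℂ) * ∫ y, (kernel y : ℂ) * exp (θ * y * I) ∂(Q n)) atTop
      (𝓝 (√(2 * Real.pi) * window θ)) := by
  have hshift := hQ.tendsto_fourier hh (T := fun s => (window (s - θ) : ℂ)) (by fun_prop)
    (b := |θ| + 1) (by positivity) fun s hs => by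
      have := abs_sub_abs_le_abs_sub s θ
      rw [window_of_one_le (by linarith), ofReal_zero]
  have hker : ∀ y : ℝ, ∫ s : ℝ, (window (s - θ) : ℂ) * exp (s * y * I)
      = (kernel y : ℂ) * exp (θ * y * I) := by
    intro y
    rw [← integral_add_right_eq_self _ θ, ← integral_window_mul_exp, ← integral_mul_const]
    congr 1 with s
    rw [add_sub_cancel_right, mul_assoc (window s : ℂ), ← exp_add]
    congr 2
    push_cast
    ring
  simpa only [hker, zero_sub, window_neg] using hshift

lemma IsGaussianScaling.tendsto_charFun_kernelMeasure (hQ : IsGaussianScaling Q h E)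
    (hh : Tendsto h atTop atTop) (θ : ℝ) :
    Tendsto (fun n => charFun (kernelMeasure (Q n)) θ) atTop
      (𝓝 (charFun (kernelMeasure (volume : Measure ℝ)) θ)) := by
  have hs : (√(2 * Real.pi) : ℂ) ≠ 0 := by
    have : √(2 * Real.pi) ≠ 0 := by have := Real.pi_pos; positivity
    exact_mod_cast this
  have h0 := hQ.tendsto_kernel_mul_exp hh 0
  have hθ := (hQ.tendsto_kernel_mul_exp hh θ).div h0 (by simpa [window_zero] using hs)
  rw [window_zero, mul_div_mul_left _ _ hs] at hθ
  rw [charFun_kernelMeasure_volume]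
  refine (hθ.congr' ?_).trans (by simp)
  filter_upwards [hh.eventually_gt_atTop 0] with n hn
  rw [charFun_kernelMeasure]
  simp only [Pi.div_apply, Complex.ofReal_zero, zero_mul, Complex.exp_zero, mul_one]
  rw [mul_div_mul_left _ _ (by exact_mod_cast hn.ne'), integral_complex_ofReal]

/-- Vague convergence of the measures `Q n`, renormalised, to Lebesgue measure. -/
lemma IsGaussianScaling.tendsto_integral_div (hQ : IsGaussianScaling Q h E)
    (hh : Tendsto h atTop atTop) {f : ℝ → ℝ} (hf : Continuous f) {C : ℝ}
    (hC : ∀ y, |f y| ≤ C * kernel y) :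
    Tendsto (fun n => (∫ y, f y ∂(Q n)) / ∫ y, kernel y ∂(Q n)) atTop
      (𝓝 ((∫ y, f y) / (4 * Real.pi))) := by
  let p : ℕ → ProbabilityMeasure ℝ := fun n => ⟨kernelMeasure (Q n), inferInstance⟩
  let p₀ : ProbabilityMeasure ℝ := ⟨kernelMeasure volume, inferInstance⟩
  have hp : Tendsto p atTop (𝓝 p₀) :=
    ProbabilityMeasure.tendsto_iff_tendsto_charFun.2 fun θ =>
      hQ.tendsto_charFun_kernelMeasure hh θ
  -- Dividing by the kernel makes the test function bounded, so weak convergence of the weighted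
  -- measures applies; the weight then restores f.
  let g : BoundedContinuousFunction ℝ ℝ := BoundedContinuousFunction.ofNormedAddCommGroup
    (fun y => f y / kernel y) (hf.div (by fun_prop) fun y => (kernel_pos y).ne') C fun y => by
      rw [norm_div, Real.norm_eq_abs, Real.norm_eq_abs, abs_of_pos (kernel_pos y),
        div_le_iff₀ (kernel_pos y)]
      exact hC y
  have hg := (ProbabilityMeasure.tendsto_iff_forall_integral_tendsto.1 hp) g
  have hcancel : ∀ y, f y / kernel y * kernel y = f y := fun y =>
    div_mul_cancel₀ _ (kernel_pos y).ne'
  have key : ∀ P : Measure ℝ, ∫ y, g y ∂kernelMeasure P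
      = (∫ y, f y ∂P) / ∫ y, kernel y ∂P := by
    intro P
    rw [integral_kernelMeasure]
    simp only [g, BoundedContinuousFunction.coe_ofNormedAddCommGroup, hcancel]
  simpa only [p, p₀, ProbabilityMeasure.coe_mk, key, integral_kernel] using hg

end Vague

/-! ### Tails weighted by exp(-y) -/

/-- A continuous truncation of `y ↦ exp (-y)`, vanishing for `y ≤ t` and exact for
`t + δ ≤ y`. -/
noncomputable def expRamp (t δ y : ℝ) : ℝ := Real.exp (-y) * min 1 (max 0 ((y - t) / δ))

lemma continuous_expRamp (t δ : ℝ) : Continuous (expRamp t δ) := by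
  unfold expRamp; fun_prop

lemma expRamp_nonneg (t δ y : ℝ) : 0 ≤ expRamp t δ y :=
  mul_nonneg (Real.exp_nonneg _) (le_min zero_le_one (le_max_left _ _))

lemma expRamp_le_indicator {t δ : ℝ} (hδ : 0 < δ) (y : ℝ) :
    expRamp t δ y ≤ (Set.Ici t).indicator (fun y => Real.exp (-y)) y := by
  by_cases hy : y ∈ Set.Ici t
  · rw [Set.indicator_of_mem hy]
    exact mul_le_of_le_one_right (Real.exp_nonneg _) (min_le_left _ _)
  · rw [Set.indicator_of_notMem hy, expRamp, max_eq_left, min_eq_right zero_le_one, mul_zero]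
    exact div_nonpos_of_nonpos_of_nonneg (by linarith [not_le.1 (show ¬ t ≤ y from hy)]) hδ.le

lemma indicator_le_expRamp {t δ : ℝ} (hδ : 0 < δ) (y : ℝ) :
    (Set.Ici (t + δ)).indicator (fun y => Real.exp (-y)) y ≤ expRamp t δ y := by
  by_cases hy : y ∈ Set.Ici (t + δ)
  · have h1 : 1 ≤ (y - t) / δ := by
      rw [le_div_iff₀ hδ]
      linarith [Set.mem_Ici.1 hy]
    rw [Set.indicator_of_mem hy, expRamp, max_eq_right (by linarith), min_eq_left h1, mul_one]
  · rw [Set.indicator_of_notMem hy]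
    exact expRamp_nonneg _ _ _

/-- The kernel decays only quadratically, so exp(-y) on a half-line is below a multiple of it. This
makes the truncated exponentials admissible test functions. -/
lemma indicator_exp_neg_le (t y : ℝ) :
    (Set.Ici t).indicator (fun y => Real.exp (-y)) y
      ≤ Real.exp (2 * |t| + Real.pi) / 2 * kernel y := by
  have hpi := Real.pi_pos
  by_cases hy : y ∈ Set.Ici t
  · rw [Set.indicator_of_mem hy]
    refine le_trans ?_ (mul_le_mul_of_nonneg_left (le_kernel y) (by positivity))
    have hq : 0 < |y| + Real.pi := by positivity
    rw [← mul_div_assoc, le_div_iff₀ (by positivity)]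
    have hty : t ≤ y := hy
    have hu : |y| ≤ y + 2 * |t| := by
      rcases abs_cases y with h | h <;> rcases abs_cases t with h' | h' <;> linarith
    have hexp := Real.quadratic_le_exp_of_nonneg (x := y + 2 * |t| + Real.pi) (by linarith)
    have hsq : (|y| + Real.pi) ^ 2 ≤ 2 * Real.exp (y + 2 * |t| + Real.pi) := by
      have : (|y| + Real.pi) ^ 2 ≤ (y + 2 * |t| + Real.pi) ^ 2 := by gcongr
      linarith
    calc Real.exp (-y) * (|y| + Real.pi) ^ 2
        ≤ Real.exp (-y) * (2 * Real.exp (y + 2 * |t| + Real.pi)) := by gcongr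
      _ = 2 * Real.exp (-y + (y + 2 * |t| + Real.pi)) := by
          rw [Real.exp_add (-y)]; ring
      _ = Real.exp (2 * |t| + Real.pi) / 2 * 4 := by
          rw [show -y + (y + 2 * |t| + Real.pi) = 2 * |t| + Real.pi by ring]; ring
  · rw [Set.indicator_of_notMem hy]
    have := kernel_pos y
    positivity

lemma integrable_indicator_exp_neg (t : ℝ) :
    Integrable ((Set.Ici t).indicator fun y => Real.exp (-y)) := by
  rw [integrable_indicator_iff measurableSet_Ici, integrableOn_Ici_iff_integrableOn_Ioi]
  exact integrableOn_exp_neg_Ioi t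

lemma integral_indicator_exp_neg (t : ℝ) :
    ∫ y, (Set.Ici t).indicator (fun y => Real.exp (-y)) y = Real.exp (-t) := by
  rw [integral_indicator measurableSet_Ici, integral_Ici_eq_integral_Ioi, integral_exp_neg_Ioi]

lemma integrable_indicator_exp_neg_of_isFiniteMeasure (P : Measure ℝ) [IsFiniteMeasure P] (t : ℝ) :
    Integrable ((Set.Ici t).indicator fun y => Real.exp (-y)) P := by
  refine ((integrable_kernel_of_isFiniteMeasure P).const_mul
    (Real.exp (2 * |t| + Real.pi) / 2)).mono'
    (Measurable.indicator (by fun_prop) measurableSet_Ici).aestronglyMeasurable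
    (.of_forall fun y => ?_)
  rw [Real.norm_eq_abs, abs_of_nonneg (Set.indicator_nonneg (fun _ _ => Real.exp_nonneg _) _)]
  exact indicator_exp_neg_le t y

lemma abs_expRamp_le {t δ : ℝ} (hδ : 0 < δ) (y : ℝ) :
    |expRamp t δ y| ≤ Real.exp (2 * |t| + Real.pi) / 2 * kernel y := by
  rw [abs_of_nonneg (expRamp_nonneg _ _ _)]
  exact (expRamp_le_indicator hδ y).trans (indicator_exp_neg_le t y)

lemma integrable_expRamp {P : Measure ℝ} (hP : Integrable kernel P) {t δ : ℝ} (hδ : 0 < δ) :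
    Integrable (expRamp t δ) P :=
  (hP.const_mul _).mono' (continuous_expRamp t δ).aestronglyMeasurable
    (.of_forall fun y => by simpa using abs_expRamp_le hδ y)

/-- The integral of `exp (-y)` over `[t, ∞)`. -/
noncomputable def expTail (P : Measure ℝ) (t : ℝ) : ℝ :=
  ∫ y, (Set.Ici t).indicator (fun y => Real.exp (-y)) y ∂P

lemma indicator_exp_neg_anti {s t : ℝ} (hst : s ≤ t) (y : ℝ) :
    (Set.Ici t).indicator (fun y => Real.exp (-y)) y
      ≤ (Set.Ici s).indicator (fun y => Real.exp (-y)) y :=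
  Set.indicator_le_indicator_of_subset (Set.Ici_subset_Ici.2 hst) (fun _ => Real.exp_nonneg _) y

section Tail

variable {Q : ℕ → Measure ℝ} [∀ n, IsProbabilityMeasure (Q n)] {h : ℕ → ℝ}
  {E : ℕ → ℝ → ℂ}

lemma integral_kernel_pos (P : Measure ℝ) [IsProbabilityMeasure P] : 0 < ∫ y, kernel y ∂P := by
  rw [integral_pos_iff_support_of_nonneg (fun y => (kernel_pos y).le)
    (integrable_kernel_of_isFiniteMeasure P)]
  have : Function.support kernel = Set.univ :=
    Set.eq_univ_of_forall fun y => (kernel_pos y).ne'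
  simp [this]

lemma IsGaussianScaling.tendsto_expTail (hQ : IsGaussianScaling Q h E)
    (hh : Tendsto h atTop atTop) {t : ℕ → ℝ} {t₀ : ℝ} (ht : Tendsto t atTop (𝓝 t₀)) :
    Tendsto (fun n => expTail (Q n) (t n) / ∫ y, kernel y ∂(Q n)) atTop
      (𝓝 (Real.exp (-t₀) / (4 * Real.pi))) := by
  have hpi := Real.pi_pos
  have hlim : ∀ s δ : ℝ, 0 < δ →
      Tendsto (fun n => (∫ y, expRamp s δ y ∂(Q n)) / ∫ y, kernel y ∂(Q n)) atTop
        (𝓝 ((∫ y, expRamp s δ y) / (4 * Real.pi))) := fun s δ hδ =>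
    hQ.tendsto_integral_div hh (continuous_expRamp s δ) (abs_expRamp_le hδ)
  have hcont : ∀ k : ℝ, Tendsto (fun δ : ℝ => Real.exp (-(t₀ + k * δ)) / (4 * Real.pi)) (𝓝[>] 0)
      (𝓝 (Real.exp (-t₀) / (4 * Real.pi))) := by
    intro k
    have : Continuous fun δ : ℝ => Real.exp (-(t₀ + k * δ)) / (4 * Real.pi) := by fun_prop
    have h0 := this.tendsto 0
    simp only [mul_zero, add_zero] at h0
    exact h0.mono_left nhdsWithin_le_nhds
  refine tendsto_order.2 ⟨fun a ha => ?_, fun a ha => ?_⟩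
  -- One δ covers the moving threshold, eventually below t₀ + δ, and a second one the width of the
  -- ramp; the upper bound below is symmetric.
  · obtain ⟨δ, hδa, hδ⟩ := (((hcont 2).eventually_const_lt ha).and self_mem_nhdsWithin).exists
    have hδ : 0 < δ := hδ
    have hI : Real.exp (-(t₀ + 2 * δ)) ≤ ∫ y, expRamp (t₀ + δ) δ y := by
      rw [← integral_indicator_exp_neg]
      refine integral_mono (integrable_indicator_exp_neg _)
        (integrable_expRamp integrable_kernel hδ) fun y => ?_
      rw [show t₀ + 2 * δ = t₀ + δ + δ by ring]
      exact indicator_le_expRamp hδ y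
    have hlt : a < (∫ y, expRamp (t₀ + δ) δ y) / (4 * Real.pi) :=
      hδa.trans_le (by gcongr)
    filter_upwards [(hlim _ δ hδ).eventually_const_lt hlt,
      ht.eventually_lt_const (show t₀ < t₀ + δ by linarith)] with n hn htn
    refine hn.trans_le ?_
    have := integral_kernel_pos (Q n)
    refine div_le_div_of_nonneg_right (integral_mono
      (integrable_expRamp (integrable_kernel_of_isFiniteMeasure _) hδ)
      (integrable_indicator_exp_neg_of_isFiniteMeasure _ _) fun y => ?_) this.le
    exact (expRamp_le_indicator hδ y).trans (indicator_exp_neg_anti htn.le y)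
  · obtain ⟨δ, hδa, hδ⟩ := (((hcont (-2)).eventually_lt_const ha).and self_mem_nhdsWithin).exists
    have hδ : 0 < δ := hδ
    have hI : ∫ y, expRamp (t₀ + -2 * δ) δ y ≤ Real.exp (-(t₀ + -2 * δ)) := by
      rw [← integral_indicator_exp_neg]
      exact integral_mono (integrable_expRamp integrable_kernel hδ)
        (integrable_indicator_exp_neg _) fun y => expRamp_le_indicator hδ y
    have hlt : (∫ y, expRamp (t₀ + -2 * δ) δ y) / (4 * Real.pi) < a :=
      lt_of_le_of_lt (by gcongr) hδa
    filter_upwards [(hlim _ δ hδ).eventually_lt_const hlt,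
      ht.eventually_const_lt (show t₀ - δ < t₀ by linarith)] with n hn htn
    refine lt_of_le_of_lt ?_ hn
    have := integral_kernel_pos (Q n)
    refine div_le_div_of_nonneg_right (integral_mono
      (integrable_indicator_exp_neg_of_isFiniteMeasure _ _)
      (integrable_expRamp (integrable_kernel_of_isFiniteMeasure _) hδ) fun y => ?_) this.le
    refine (indicator_exp_neg_anti ?_ y).trans (indicator_le_expRamp hδ y)
    linarith

lemma IsGaussianScaling.tendsto_expTail_ratio (hQ : IsGaussianScaling Q h E)
    (hh : Tendsto h atTop atTop) {t : ℕ → ℝ} {t₀ : ℝ} (ht : Tendsto t atTop (𝓝 t₀)) :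
    Tendsto (fun n => expTail (Q n) (t n) / expTail (Q n) 0) atTop (𝓝 (Real.exp (-t₀))) := by
  have hpi := Real.pi_pos
  have h0 := hQ.tendsto_expTail hh (tendsto_const_nhds (x := (0 : ℝ)))
  have h1 := (hQ.tendsto_expTail hh ht).div h0 (by positivity)
  rw [neg_zero, Real.exp_zero, div_div_div_cancel_right₀ (by positivity), div_one] at h1
  refine h1.congr fun n => ?_
  exact div_div_div_cancel_right₀ (integral_kernel_pos (Q n)).ne' _ _

lemma IsGaussianScaling.eventually_expTail_zero_pos (hQ : IsGaussianScaling Q h E)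
    (hh : Tendsto h atTop atTop) : ∀ᶠ n in atTop, 0 < expTail (Q n) 0 := by
  have hpi := Real.pi_pos
  have h0 := hQ.tendsto_expTail hh (tendsto_const_nhds (x := (0 : ℝ)))
  filter_upwards [h0.eventually_const_lt (show (0 : ℝ) < _ by positivity)] with n hn
  exact (div_pos_iff_of_pos_right (integral_kernel_pos (Q n))).1 hn

end Tail

/-! ### Taylor remainders and cumulant generating functions -/

open Complex in
-- Cauchy's estimate on circles of radius s < r, then s → r, since the bound is only available in
-- the open ball.
lemma norm_iteratedDeriv_le_of_forall_mem_ball {f : ℂ → ℂ} {c : ℂ} {r M : ℝ} (hr : 0 < r)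
    (hf : DifferentiableOn ℂ f (Metric.ball c r)) (hM : ∀ z ∈ Metric.ball c r, ‖f z‖ ≤ M) (k : ℕ) :
    ‖iteratedDeriv k f c‖ ≤ k.factorial * M / r ^ k := by
  have hlim : Tendsto (fun s : ℝ => k.factorial * M / s ^ k) (𝓝[<] r)
      (𝓝 (k.factorial * M / r ^ k)) := by
    refine Tendsto.mono_left ?_ nhdsWithin_le_nhds
    exact tendsto_const_nhds.div ((continuous_pow k).tendsto r) (by positivity)
  refine ge_of_tendsto hlim ?_
  filter_upwards [self_mem_nhdsWithin, mem_nhdsWithin_of_mem_nhds (lt_mem_nhds hr)] with s hs h0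
  have hsub : Metric.closedBall c s ⊆ Metric.ball c r := Metric.closedBall_subset_ball hs
  refine norm_iteratedDeriv_le_of_forall_mem_sphere_norm_le k h0
    (DifferentiableOn.diffContOnCl (hf.mono ?_)) fun z hz => hM z (hsub ?_)
  · rwa [closure_ball c h0.ne']
  · exact Metric.sphere_subset_closedBall hz

open Complex in
/-- The remainder of the Taylor polynomial of degree less than `k` of a bounded analytic
function. -/
lemma norm_sub_taylor_le {f : ℂ → ℂ} {c : ℂ} {r M : ℝ} (hr : 0 < r)
    (hf : DifferentiableOn ℂ f (Metric.ball c r)) (hM : ∀ z ∈ Metric.ball c r, ‖f z‖ ≤ M) (k : ℕ)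
    {z : ℂ} (hz : ‖z - c‖ ≤ r / 2) :
    ‖f z - ∑ i ∈ Finset.range k, ((i.factorial : ℂ)⁻¹ * (z - c) ^ i * iteratedDeriv i f c)‖
      ≤ 2 * M * (‖z - c‖ / r) ^ k := by
  have hM0 : 0 ≤ M := (norm_nonneg _).trans (hM c (Metric.mem_ball_self hr))
  have hzr : z ∈ Metric.ball c r := by rw [mem_ball_iff_norm]; linarith
  have hsum := hasSum_taylorSeries_on_ball hf hzr
  simp only [smul_eq_mul, ← mul_assoc] at hsum
  rw [← hasSum_nat_add_iff' k] at hsum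
  set q := ‖z - c‖ / r with hq
  have hq0 : 0 ≤ q := by positivity
  have hq1 : q ≤ 1 / 2 := by rw [hq, div_le_iff₀ hr]; linarith
  have hgeom : HasSum (fun i : ℕ => M * q ^ k * q ^ i) (M * q ^ k * (1 - q)⁻¹) :=
    (hasSum_geometric_of_lt_one hq0 (by linarith)).mul_left _
  have hterm : ∀ i : ℕ, ‖((i + k).factorial : ℂ)⁻¹ * (z - c) ^ (i + k) * iteratedDeriv (i + k) f c‖
      ≤ M * q ^ k * q ^ i := by
    intro i
    have hd := norm_iteratedDeriv_le_of_forall_mem_ball hr hf hM (i + k)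
    have hfac : (0 : ℝ) < (i + k).factorial := by positivity
    rw [norm_mul, norm_mul, norm_inv, norm_pow, norm_natCast]
    calc _ ≤ ((i + k).factorial : ℝ)⁻¹ * ‖z - c‖ ^ (i + k)
          * ((i + k).factorial * M / r ^ (i + k)) := by gcongr
      _ = M * q ^ k * q ^ i := by
          rw [hq, div_pow, div_pow, pow_add, pow_add]
          field_simp
  refine (hsum.norm_le_of_bounded hgeom hterm).trans ?_
  have hinv : (1 - q)⁻¹ ≤ 2 := by
    rw [inv_le_comm₀ (by linarith) two_pos]
    linarith
  calc M * q ^ k * (1 - q)⁻¹ ≤ M * q ^ k * 2 := by gcongr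
    _ = _ := by ring

lemma IsCGFOnDisc.mem_integrableExpSet {Ω : Type*} [MeasurableSpace Ω] {μ : Measure Ω} {Y : Ω → ℝ}
    {r : ℝ} {L : ℂ → ℂ} (hL : IsCGFOnDisc Y μ r L) {u : ℝ} (hu : |u| < r) :
    u ∈ integrableExpSet Y μ := by
  have := (hL.integrable u (by simpa using hu)).norm
  simpa [Complex.norm_exp, integrableExpSet] using this

/-- The cumulant generating function of a centred variable agrees with `v z² / 2` to third
order. -/
lemma IsCGFOnDisc.norm_sub_le {Ω : Type*} [MeasurableSpace Ω] {μ : Measure Ω}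
    [IsProbabilityMeasure μ] {Y : Ω → ℝ} {r : ℝ} {L : ℂ → ℂ} (hL : IsCGFOnDisc Y μ r L)
    (hr : 0 < r) (hY : AEMeasurable Y μ) (hmean : μ[Y] = 0) {C : ℝ}
    (hC : ∀ z : ℂ, ‖z‖ < r → ‖L z‖ ≤ C) {z : ℂ} (hz : ‖z‖ ≤ r / 2) :
    ‖L z - Var[Y; μ] * z ^ 2 / 2‖ ≤ 2 * C * (‖z‖ / r) ^ 3 := by
  have hint : ∀ w : ℂ, ‖w‖ < r → w.re ∈ interior (integrableExpSet Y μ) := by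
    intro w hw
    refine mem_interior.2 ⟨Set.Ioo (-r) r, fun u hu =>
      hL.mem_integrableExpSet (abs_lt.2 hu), isOpen_Ioo, ?_⟩
    exact abs_lt.1 ((Complex.abs_re_le_norm w).trans_lt hw)
  have hball : Metric.ball (0 : ℂ) r ∈ 𝓝 (0 : ℂ) := Metric.ball_mem_nhds _ hr
  -- Differentiating this identity once and twice at 0 gives L'(0) = E Y = 0 and L''(0) = E Y², the
  -- variance.
  have heq : (fun z => Complex.exp (L z)) =ᶠ[𝓝 0] complexMGF Y μ := by
    filter_upwards [hball] with w hw
    exact hL.exp_eq w (by simpa using hw)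
  have hLd : ∀ w ∈ Metric.ball (0 : ℂ) r, DifferentiableAt ℂ L w := fun w hw =>
    (hL.analytic w hw).differentiableAt
  have hmean' : ∫ ω, (Y ω : ℂ) ∂μ = 0 := by
    rw [integral_complex_ofReal]
    exact_mod_cast hmean
  have hvar : ∫ ω, (Y ω : ℂ) ^ 2 ∂μ = Var[Y; μ] := by
    rw [variance_of_integral_eq_zero hY hmean, ← integral_complex_ofReal]
    congr 1 with ω
    push_cast
    rfl
  have h1 : deriv L 0 = 0 := by
    have ha := (hasDerivAt_complexMGF (hint 0 (by simpa using hr))).deriv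
    have hb := ((hLd 0 (Metric.mem_ball_self hr)).hasDerivAt.cexp).deriv
    rw [heq.deriv_eq, ha, hL.map_zero] at hb
    simpa [hmean'] using hb.symm
  have h2 : iteratedDeriv 2 L 0 = Var[Y; μ] := by
    have ha := iteratedDeriv_complexMGF (hint 0 (by simpa using hr)) 2
    rw [← heq.iteratedDeriv_eq, iteratedDeriv_succ, iteratedDeriv_one] at ha
    have hd : deriv (fun z => Complex.exp (L z)) =ᶠ[𝓝 0]
        fun z => Complex.exp (L z) * deriv L z := by
      filter_upwards [hball] with w hw
      exact (hLd w hw).hasDerivAt.cexp.deriv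
    have hdL : DifferentiableAt ℂ (deriv L) 0 :=
      ((hL.analytic 0 (Metric.mem_ball_self hr)).deriv).differentiableAt
    have hm : HasDerivAt (fun z => Complex.exp (L z) * deriv L z) _ 0 :=
      (hLd 0 (Metric.mem_ball_self hr)).hasDerivAt.cexp.mul hdL.hasDerivAt
    rw [hd.deriv_eq, hm.deriv] at ha
    rw [iteratedDeriv_succ, iteratedDeriv_one]
    simpa [h1, hL.map_zero, hvar] using ha
  have h := norm_sub_taylor_le hr (fun w hw => (hLd w hw).differentiableWithinAt)
    (fun w hw => hC w (by simpa using hw)) 3 (z := z) (by simpa using hz)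
  simp only [Finset.sum_range_succ, Finset.sum_range_zero, iteratedDeriv_zero, iteratedDeriv_one,
    h1, h2, hL.map_zero, sub_zero] at h
  convert h using 2
  norm_num
  ring

/-! ### Cubic remainder and saddle point -/

/-- The complex moment generating function of `W` is `exp (z² / 2 + R z)` on the disc of radius
`D`, where `R` is analytic and of third order. -/
structure HasCubicRemainder {Ω : Type*} [MeasurableSpace Ω] (W : Ω → ℝ) (μ : Measure Ω)
    (R : ℂ → ℂ) (m D : ℝ) : Prop where
  aemeasurable : AEMeasurable W μ
  pos : 0 < D
  nonneg : 0 ≤ m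
  mem_integrableExpSet : ∀ u : ℝ, |u| < D → u ∈ integrableExpSet W μ
  differentiableOn : DifferentiableOn ℂ R (Metric.ball 0 D)
  norm_le : ∀ z : ℂ, ‖z‖ < D → ‖R z‖ ≤ m * ‖z‖ ^ 3 / D
  complexMGF_eq : ∀ z : ℂ, ‖z‖ < D → complexMGF W μ z = Complex.exp (z ^ 2 / 2 + R z)

namespace HasCubicRemainder

variable {Ω : Type*} [MeasurableSpace Ω] {W : Ω → ℝ} {μ : Measure Ω} {R : ℂ → ℂ} {m D : ℝ}

lemma differentiableAt (hR : HasCubicRemainder W μ R m D) {z : ℂ} (hz : ‖z‖ < D) :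
    DifferentiableAt ℂ R z :=
  hR.differentiableOn.differentiableAt (Metric.isOpen_ball.mem_nhds (by simpa using hz))

/-- Cauchy's estimate on the circle of radius ρ about z, which stays in |w| ≤ 2ρ; hence 8 = 2³. -/
lemma norm_deriv_le (hR : HasCubicRemainder W μ R m D) {ρ : ℝ} (hρ : 0 < ρ) (hρD : 2 * ρ < D)
    {z : ℂ} (hz : ‖z‖ ≤ ρ) : ‖deriv R z‖ ≤ 8 * m * ρ ^ 2 / D := by
  have hD := hR.pos
  have hm := hR.nonneg
  have hnorm : ∀ w ∈ Metric.closedBall z ρ, ‖w‖ ≤ 2 * ρ := by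
    intro w hw
    have h1 := mem_closedBall_iff_norm.1 hw
    have h2 := norm_add_le (w - z) z
    rw [sub_add_cancel] at h2
    linarith
  have h := Complex.norm_deriv_le_of_forall_mem_sphere_norm_le (f := R) (c := z)
    (C := m * (2 * ρ) ^ 3 / D) hρ
    (DifferentiableOn.diffContOnCl (by
      rw [closure_ball z hρ.ne']
      exact fun w hw => (hR.differentiableAt ((hnorm w hw).trans_lt hρD)).differentiableWithinAt))
    fun w hw => by
      have hw' := hnorm w (Metric.sphere_subset_closedBall hw)
      exact (hR.norm_le w (hw'.trans_lt hρD)).trans (by gcongr)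
  refine h.trans (le_of_eq ?_)
  field_simp
  ring

/-- Second-order Taylor remainder on the ball of radius 2ρ about h, where |R| ≤ m(3ρ)³/D: the
constant is 2 · 27 / 4. It controls the error in the exponent of the tilted characteristic function.
-/
lemma norm_sub_sub_le (hR : HasCubicRemainder W μ R m D) {ρ : ℝ} (hρ : 0 < ρ) (hρD : 3 * ρ < D)
    {h z : ℂ} (hh : ‖h‖ ≤ ρ) (hz : ‖z‖ ≤ ρ) :
    ‖R (h + z) - R h - z * deriv R h‖ ≤ 27 / 2 * m * ρ / D * ‖z‖ ^ 2 := by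
  have hD := hR.pos
  have hm := hR.nonneg
  have hnorm : ∀ w ∈ Metric.ball h (2 * ρ), ‖w‖ < 3 * ρ := by
    intro w hw
    have h1 := mem_ball_iff_norm.1 hw
    have h2 := norm_add_le (w - h) h
    rw [sub_add_cancel] at h2
    linarith
  have key := norm_sub_taylor_le (f := R) (c := h) (r := 2 * ρ) (M := m * (3 * ρ) ^ 3 / D)
    (by positivity)
    (fun w hw => (hR.differentiableAt ((hnorm w hw).trans hρD)).differentiableWithinAt)
    (fun w hw => (hR.norm_le w ((hnorm w hw).trans hρD)).trans (by
      have := (hnorm w hw).le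
      gcongr)) 2 (z := h + z) (by simpa using hz)
  simp only [Finset.sum_range_succ, Finset.sum_range_zero, iteratedDeriv_zero, iteratedDeriv_one,
    add_sub_cancel_left] at key
  convert key using 1
  · congr 1
    simp
    ring
  · field_simp
    ring

lemma mem_interior_integrableExpSet (hR : HasCubicRemainder W μ R m D) {u : ℝ} (hu : |u| < D) :
    u ∈ interior (integrableExpSet W μ) :=
  mem_interior.2 ⟨Set.Ioo (-D) D, fun v hv => hR.mem_integrableExpSet v (abs_lt.2 hv), isOpen_Ioo,
    abs_lt.1 hu⟩

/-- On the real axis u + R'(u) is the logarithmic derivative of the moment generating function, a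
quotient of real numbers. The saddle equation thus becomes real. -/
lemma deriv_im_eq_zero [IsProbabilityMeasure μ] (hR : HasCubicRemainder W μ R m D) {u : ℝ}
    (hu : |u| < D) : (deriv R u).im = 0 := by
  have hu' : ‖(u : ℂ)‖ < D := by simpa using hu
  have hball : Metric.ball (0 : ℂ) D ∈ 𝓝 (u : ℂ) :=
    Metric.isOpen_ball.mem_nhds (by simpa using hu)
  have heq : complexMGF W μ =ᶠ[𝓝 (u : ℂ)] fun z => Complex.exp (z ^ 2 / 2 + R z) := by
    filter_upwards [hball] with w hw
    exact hR.complexMGF_eq w (by simpa using hw)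
  have ha := hasDerivAt_complexMGF (X := W) (μ := μ) (z := (u : ℂ))
    (hR.mem_interior_integrableExpSet (by simpa using hu))
  have hb : HasDerivAt (fun z => Complex.exp (z ^ 2 / 2 + R z))
      (Complex.exp (u ^ 2 / 2 + R u) * (u + deriv R u)) (u : ℂ) := by
    have h2 := ((hasDerivAt_pow 2 (u : ℂ)).div_const 2).add
      (hR.differentiableAt hu').hasDerivAt
    refine HasDerivAt.cexp (f := fun z => z ^ 2 / 2 + R z) (h2.congr_deriv ?_)
    norm_num
  have hc := (ha.congr_of_eventuallyEq heq.symm).unique hb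
  rw [← hR.complexMGF_eq _ hu', complexMGF_ofReal] at hc
  have hreal : ∫ ω, (W ω : ℂ) * Complex.exp (u * W ω) ∂μ
      = ((∫ ω, W ω * Real.exp (u * W ω) ∂μ : ℝ) : ℂ) := by
    rw [← integral_complex_ofReal]
    congr 1 with ω
    push_cast
    rfl
  have him := congrArg Complex.im hc
  rw [hreal, Complex.ofReal_im, Complex.im_ofReal_mul, Complex.add_im, Complex.ofReal_im,
    zero_add] at him
  have hpos : 0 < mgf W μ u := mgf_pos (hR.mem_integrableExpSet u hu)
  exact (mul_eq_zero.1 him.symm).resolve_left hpos.ne'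

/-- The saddle point. -/
lemma exists_saddle [IsProbabilityMeasure μ] (hR : HasCubicRemainder W μ R m D) {x : ℝ}
    (hx : 0 < x) (hxD : 4 * x < D) (hmx : 64 * m * x ≤ D) :
    ∃ h : ℝ, x / 2 ≤ h ∧ h ≤ 2 * x ∧ (h + deriv R h : ℂ) = x ∧ |h - x| ≤ 32 * m * x ^ 2 / D := by
  have hD := hR.pos
  have hbound : ∀ u ∈ Set.Icc (x / 2) (2 * x), |(deriv R u).re| ≤ 32 * m * x ^ 2 / D := by
    intro u hu
    have hu' : ‖(u : ℂ)‖ ≤ 2 * x := by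
      rw [Complex.norm_real, Real.norm_eq_abs, abs_of_nonneg (by linarith [hu.1])]
      exact hu.2
    refine (Complex.abs_re_le_norm _).trans ((hR.norm_deriv_le (by linarith)
      (by linarith) hu').trans (le_of_eq ?_))
    ring
  -- With |R'| ≤ x/2, the function u + Re R'(u) is at most x at u = x/2 and at least x at u = 2x, so
  -- the intermediate value theorem applies.
  have hhalf : 32 * m * x ^ 2 / D ≤ x / 2 := by
    rw [div_le_iff₀ hD]
    nlinarith
  have hcont : ContinuousOn (fun u : ℝ => u + (deriv R u).re) (Set.Icc (x / 2) (2 * x)) := by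
    refine continuousOn_id.add (Complex.continuous_re.comp_continuousOn
      ((hR.differentiableOn.deriv Metric.isOpen_ball).continuousOn.comp
        Complex.continuous_ofReal.continuousOn fun u hu => ?_))
    rw [mem_ball_zero_iff, Complex.norm_real, Real.norm_eq_abs,
      abs_of_nonneg (by linarith [hu.1])]
    linarith [hu.2]
  have hl := abs_le.1 (hbound (x / 2) ⟨le_rfl, by linarith⟩)
  have hr := abs_le.1 (hbound (2 * x) ⟨by linarith, le_rfl⟩)
  obtain ⟨h, hh, hsad⟩ := intermediate_value_Icc (by linarith : x / 2 ≤ 2 * x) hcont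
    (show x ∈ Set.Icc _ _ from ⟨by linarith, by linarith⟩)
  have hsad : h + (deriv R h).re = x := hsad
  refine ⟨h, hh.1, hh.2, ?_, ?_⟩
  · have him := hR.deriv_im_eq_zero (u := h) (by
      rw [abs_of_nonneg (by linarith [hh.1])]
      linarith [hh.2])
    apply Complex.ext <;> simp [him, hsad]
  · have : h - x = -(deriv R h).re := by linarith
    rw [this, abs_neg]
    exact hbound h hh

end HasCubicRemainder

/-! ### Exponential tilting -/

section Tilt

variable {Ω : Type*} [MeasurableSpace Ω] {W : Ω → ℝ} {μ : Measure Ω}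

/-- The law of `h (W - x)` under the measure tilted by `h W`. -/
noncomputable def tiltedLaw (W : Ω → ℝ) (μ : Measure Ω) (h x : ℝ) : Measure ℝ :=
  (μ.tilted fun ω => h * W ω).map fun ω => h * (W ω - x)

lemma aemeasurable_tilted (hW : AEMeasurable W μ) (h x : ℝ) :
    AEMeasurable (fun ω => h * (W ω - x)) (μ.tilted fun ω => h * W ω) :=
  AEMeasurable.mono_ac (by fun_prop) (tilted_absolutelyContinuous μ _)

lemma isProbabilityMeasure_tiltedLaw [IsProbabilityMeasure μ] (hW : AEMeasurable W μ) {h x : ℝ}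
    (hh : h ∈ integrableExpSet W μ) : IsProbabilityMeasure (tiltedLaw W μ h x) := by
  have := isProbabilityMeasure_tilted (μ := μ) (f := fun ω => h * W ω) hh
  exact Measure.isProbabilityMeasure_map (aemeasurable_tilted hW h x)

lemma charFun_tiltedLaw (hW : AEMeasurable W μ) {h : ℝ} (hh : h ≠ 0) (x t : ℝ) :
    charFun (tiltedLaw W μ h x) (t / h)
      = complexMGF W μ (h + t * Complex.I) * Complex.exp (-(t * x * Complex.I)) / mgf W μ h := by
  have hhc : (h : ℂ) ≠ 0 := by exact_mod_cast hh
  rw [charFun_apply_real, tiltedLaw, integral_map (aemeasurable_tilted hW h x) (by fun_prop),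
    integral_tilted, complexMGF, ← integral_mul_const, ← integral_div]
  congr 1 with ω
  rw [Complex.real_smul, mgf]
  push_cast
  rw [div_mul_eq_mul_div, ← Complex.exp_add, ← Complex.exp_add]
  congr 2
  field_simp
  ring

/-- The weight exp(-h(W - x)) cancels the tilting density up to a constant independent of b, which
disappears in ratios of tails. -/
lemma expTail_tiltedLaw [IsProbabilityMeasure μ] (hW : AEMeasurable W μ) {h : ℝ} (hh : 0 < h)
    (x b : ℝ) :
    expTail (tiltedLaw W μ h x) (h * b)
      = Real.exp (h * x) / mgf W μ h * μ.real {ω | x + b ≤ W ω} := by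
  have hset : NullMeasurableSet {ω | x + b ≤ W ω} μ :=
    nullMeasurableSet_le aemeasurable_const hW
  rw [expTail, tiltedLaw, integral_map (aemeasurable_tilted hW h x)
    (Measurable.indicator (by fun_prop) measurableSet_Ici).aestronglyMeasurable,
    integral_tilted, ← setIntegral_one_eq_measureReal, ← integral_indicator₀ hset,
    ← integral_const_mul]
  congr 1 with ω
  have hiff : h * (W ω - x) ∈ Set.Ici (h * b) ↔ ω ∈ {ω | x + b ≤ W ω} := by
    rw [Set.mem_Ici, Set.mem_ofPred_eq, mul_le_mul_iff_right₀ hh]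
    constructor <;> intro <;> linarith
  by_cases hω : ω ∈ {ω | x + b ≤ W ω}
  · rw [Set.indicator_of_mem hω, Set.indicator_of_mem (hiff.2 hω), smul_eq_mul, mul_one,
      div_mul_eq_mul_div, ← Real.exp_add, mgf]
    congr 2
    ring
  · rw [Set.indicator_of_notMem hω, Set.indicator_of_notMem (fun h' => hω (hiff.1 h')), smul_zero,
      mul_zero]

end Tilt

/-! ### The large deviation ratio -/

section Core

variable {Ω : Type*} [MeasurableSpace Ω] {μ : Measure Ω}

/-- In (h + it)²/2 - h²/2 - itx the linear part is it(h - x) = -itR'(h) by the saddle equation,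
which leaves exactly the second-order Taylor remainder of R. -/
lemma HasCubicRemainder.charFun_tiltedLaw_eq {W : Ω → ℝ} {R : ℂ → ℂ} {m D : ℝ}
    (hR : HasCubicRemainder W μ R m D) {h x : ℝ} (h0 : 0 < h) (hD : h < D)
    (hsad : (h + deriv R h : ℂ) = x) {t : ℝ} (ht : h + |t| < D) :
    charFun (tiltedLaw W μ h x) (t / h) = Complex.exp (-t ^ 2 / 2 +
      (R (h + t * Complex.I) - R h - t * Complex.I * deriv R h)) := by
  have hn : ‖(h + t * Complex.I : ℂ)‖ < D := by
    refine (norm_add_le _ _).trans_lt ?_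
    simpa [abs_of_pos h0] using ht
  have hn' : ‖(h : ℂ)‖ < D := by simpa [abs_of_pos h0] using hD
  rw [charFun_tiltedLaw hR.aemeasurable h0.ne', ← complexMGF_ofReal, hR.complexMGF_eq _ hn,
    hR.complexMGF_eq _ hn', ← Complex.exp_add, ← Complex.exp_sub, ← hsad]
  congr 1
  linear_combination (t ^ 2 / 2 : ℂ) * Complex.I_sq

/-- Large deviation ratio at the scale `1 / x n` for variables whose cumulant generating functions
are close to that of the standard normal law. -/
theorem tendsto_measure_ratio [IsProbabilityMeasure μ] {W : ℕ → Ω → ℝ} {R : ℕ → ℂ → ℂ} {m : ℝ} {D x : ℕ → ℝ}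
    (hR : ∀ n, HasCubicRemainder (W n) μ (R n) m (D n))
    (hx : Tendsto x atTop atTop) (hxD : Tendsto (fun n => x n / D n) atTop (𝓝 0))
    (hx0 : ∀ n, 0 < x n) (hxD4 : ∀ n, 4 * x n < D n) (hmx : ∀ n, 64 * m * x n ≤ D n) (a : ℝ) :
    Tendsto (fun n => μ.real {ω | x n + a / x n ≤ W n ω} / μ.real {ω | x n ≤ W n ω}) atTop
      (𝓝 (Real.exp (-a))) ∧ ∀ᶠ n in atTop, 0 < μ.real {ω | x n ≤ W n ω} := by
  have hm : 0 ≤ m := (hR 0).nonneg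
  have hD : ∀ n, 0 < D n := fun n => (hR n).pos
  choose h hlow hup hsad hclose using fun n => (hR n).exists_saddle (hx0 n) (hxD4 n) (hmx n)
  have hh0 : ∀ n, 0 < h n := fun n => by linarith [hlow n, hx0 n]
  have hhD : ∀ n, h n < D n := fun n => by linarith [hup n, hx0 n, hxD4 n]
  have hmem : ∀ n, h n ∈ integrableExpSet (W n) μ := fun n =>
    (hR n).mem_integrableExpSet _ (by rw [abs_of_pos (hh0 n)]; exact hhD n)
  have hh : Tendsto h atTop atTop :=
    tendsto_atTop_mono hlow (hx.atTop_div_const two_pos)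
  have := fun n => isProbabilityMeasure_tiltedLaw (x := x n) (hR n).aemeasurable (hmem n)
  have hQ : IsGaussianScaling (fun n => tiltedLaw (W n) μ (h n) (x n)) h fun n t =>
      R n (h n + t * Complex.I) - R n (h n) - t * Complex.I * deriv (R n) (h n) := by
    intro A hA ε hε
    -- With ρ = (A + 1)h ≤ 2(A + 1)x, the first bound on x/D gives 3ρ < D, and the second makes the
    -- error coefficient (27/2)mρ/D at most ε.
    have hη : 0 < min (1 / (6 * (A + 1))) (ε / (27 * (m + 1) * (A + 1))) := by positivity
    filter_upwards [hxD.eventually_lt_const hη] with n hn t ht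
    have hn1 := hn.trans_le (min_le_left _ _)
    have hn2 := hn.trans_le (min_le_right _ _)
    rw [div_lt_div_iff₀ (hD n) (by positivity)] at hn1 hn2
    have hρ : 0 < (A + 1) * h n := mul_pos (by linarith) (hh0 n)
    have hρx : (A + 1) * h n ≤ (A + 1) * (2 * x n) :=
      mul_le_mul_of_nonneg_left (hup n) (by linarith)
    have hρD : 3 * ((A + 1) * h n) < D n := by linarith
    have hAh : A * h n ≤ (A + 1) * h n := by linarith [hh0 n]
    have hle : h n ≤ (A + 1) * h n := by nlinarith [hh0 n]
    refine ⟨?_, (hR n).charFun_tiltedLaw_eq (hh0 n) (hhD n) (hsad n) (by linarith)⟩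
    refine ((hR n).norm_sub_sub_le hρ hρD (h := (h n : ℂ)) (z := t * Complex.I)
      (by simpa [abs_of_pos (hh0 n)] using hle) (by simpa using ht.trans hAh)).trans ?_
    have hnt : ‖(t * Complex.I : ℂ)‖ ^ 2 = t ^ 2 := by simp
    rw [hnt]
    refine mul_le_mul_of_nonneg_right ?_ (sq_nonneg t)
    rw [div_le_iff₀ (hD n)]
    have h1 : 27 / 2 * m * ((A + 1) * h n) ≤ 27 / 2 * m * ((A + 1) * (2 * x n)) :=
      mul_le_mul_of_nonneg_left hρx (by positivity)
    have h2 : 0 ≤ x n * (A + 1) := mul_nonneg (hx0 n).le (by linarith)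
    nlinarith
  -- Only the relative error of h matters: the threshold a/x for W - x becomes ha/x under the
  -- scaling by h.
  have hhx : Tendsto (fun n => h n / x n) atTop (𝓝 1) := by
    rw [tendsto_iff_dist_tendsto_zero]
    have hz := hxD.const_mul (32 * m)
    rw [mul_zero] at hz
    refine squeeze_zero (fun _ => dist_nonneg) (fun n => ?_) hz
    rw [Real.dist_eq, div_sub_one (hx0 n).ne', abs_div, abs_of_pos (hx0 n), div_le_iff₀ (hx0 n)]
    refine (hclose n).trans (le_of_eq ?_)
    ring
  have ht : Tendsto (fun n => h n * (a / x n)) atTop (𝓝 a) := by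
    have := hhx.mul_const a
    rw [one_mul] at this
    refine this.congr fun n => ?_
    ring
  have hratio := hQ.tendsto_expTail_ratio hh ht
  have htail : ∀ n b, expTail (tiltedLaw (W n) μ (h n) (x n)) (h n * b)
      = Real.exp (h n * x n) / mgf (W n) μ (h n) * μ.real {ω | x n + b ≤ W n ω} := fun n b =>
    expTail_tiltedLaw (hR n).aemeasurable (hh0 n) (x n) b
  have hc : ∀ n, 0 < Real.exp (h n * x n) / mgf (W n) μ (h n) := fun n =>
    div_pos (Real.exp_pos _) (mgf_pos (hmem n))
  have htail0 : ∀ n, expTail (tiltedLaw (W n) μ (h n) (x n)) 0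
      = Real.exp (h n * x n) / mgf (W n) μ (h n) * μ.real {ω | x n ≤ W n ω} := fun n => by
    simpa using htail n 0
  constructor
  · refine hratio.congr fun n => ?_
    rw [htail, htail0, mul_div_mul_left _ _ (hc n).ne']
  · filter_upwards [hQ.eventually_expTail_zero_pos hh] with n hn
    rw [htail0] at hn
    exact pos_of_mul_pos_right hn (hc n).le

end Core

/-! ### Moment generating function of the field sum -/

section FieldSum

variable {Ω : Type*} [MeasurableSpace Ω] {μ : Measure Ω} {d : ℕ}
  {Y : (Fin d → ℤ) → Ω → ℝ} {T : Ω → ℝ}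

lemma tendsto_cube (d : ℕ) : Tendsto (cube d) atTop atTop := by
  refine tendsto_atTop_finset_of_monotone (fun m n hmn => ?_) fun j => ?_
  · refine Finset.Icc_subset_Icc (fun i => ?_) fun i => ?_ <;> simpa using hmn
  · refine ⟨∑ i, (j i).natAbs, Finset.mem_Icc.2 ?_⟩
    have hj : ∀ i, |j i| ≤ ((∑ i, (j i).natAbs : ℕ) : ℤ) := fun i => by
      rw [← Int.natCast_natAbs]
      exact_mod_cast Finset.single_le_sum (f := fun i => (j i).natAbs)
        (fun _ _ => Nat.zero_le _) (Finset.mem_univ i)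
    exact ⟨fun i => (abs_le.1 (hj i)).1, fun i => (abs_le.1 (hj i)).2⟩

lemma measurable_cubeSum (hY : ∀ j, Measurable (Y j)) (m : ℕ) : Measurable (cubeSum Y m) :=
  Finset.measurable_sum _ fun j _ => hY j

lemma IsFieldSum.aemeasurable (hT : IsFieldSum Y μ T) (hY : ∀ j, Measurable (Y j)) :
    AEMeasurable T μ :=
  TendstoInMeasure.aemeasurable (fun m => (measurable_cubeSum hY m).aemeasurable) hT

section CGF

variable {r : ℝ} {L : (Fin d → ℤ) → ℂ → ℂ} {c : (Fin d → ℤ) → ℝ}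

lemma tendsto_exp_sum_cube (hLc : ∀ j, ∀ z : ℂ, ‖z‖ < r → ‖L j z‖ ≤ c j) (hc : Summable c)
    {z : ℂ} (hz : ‖z‖ < r) :
    Tendsto (fun m => Complex.exp (∑ j ∈ cube d m, L j z)) atTop
      (𝓝 (Complex.exp (∑' j, L j z))) := by
  have hs : Summable fun j => L j z := hc.of_norm_bounded fun j => hLc j z hz
  exact (Complex.continuous_exp.tendsto _).comp (hs.hasSum.comp (tendsto_cube d))

lemma charFun_map_cubeSum [IsProbabilityMeasure μ]
    (hY : ∀ j, Measurable (Y j)) (hind : iIndepFun Y μ)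
    (hL : ∀ j, IsCGFOnDisc (Y j) μ r (L j)) (m : ℕ) {t : ℝ} (ht : |t| < r) :
    charFun (μ.map (cubeSum Y m)) t = Complex.exp (∑ j ∈ cube d m, L j (t * Complex.I)) := by
  have hind' : iIndepFun ((cube d m).restrict Y) μ :=
    hind.precomp (g := fun j : cube d m => (j : Fin d → ℤ)) Subtype.val_injective
  have h := congrFun (iIndepFun.charFun_map_fun_finsetSum_eq_prod (s := cube d m)
    (fun j _ => (hY j).aemeasurable) hind') t
  rw [show cubeSum Y m = fun ω => ∑ j ∈ cube d m, Y j ω from rfl, h, Finset.prod_apply,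
    Complex.exp_sum]
  refine Finset.prod_congr rfl fun j _ => ?_
  rw [(hL j).exp_eq _ (by simpa using ht), complexMGF_mul_I (hY j).aemeasurable]

lemma mgf_cubeSum (hY : ∀ j, Measurable (Y j)) (hind : iIndepFun Y μ)
    (hL : ∀ j, IsCGFOnDisc (Y j) μ r (L j)) (m : ℕ) {u : ℝ} (hu : |u| < r) :
    (mgf (cubeSum Y m) μ u : ℂ) = Complex.exp (∑ j ∈ cube d m, L j u) := by
  have hsum : cubeSum Y m = ∑ j ∈ cube d m, Y j := by
    ext ω
    simp [cubeSum]
  rw [hsum, hind.mgf_sum hY, Complex.exp_sum]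
  push_cast
  refine Finset.prod_congr rfl fun j _ => ?_
  rw [(hL j).exp_eq _ (by simpa using hu), complexMGF_ofReal]

/-- Fatou along an almost surely convergent subsequence of the cube sums, whose moment generating
functions are all bounded by exp(∑ c). -/
lemma IsFieldSum.mem_integrableExpSet [IsProbabilityMeasure μ]
    (hT : IsFieldSum Y μ T) (hY : ∀ j, Measurable (Y j))
    (hind : iIndepFun Y μ) (hL : ∀ j, IsCGFOnDisc (Y j) μ r (L j))
    (hLc : ∀ j, ∀ z : ℂ, ‖z‖ < r → ‖L j z‖ ≤ c j) (hc : Summable c) {u : ℝ} (hu : |u| < r) :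
    u ∈ integrableExpSet T μ := by
  obtain ⟨ns, -, hns⟩ := TendstoInMeasure.exists_seq_tendsto_ae hT
  have hTm := hT.aemeasurable hY
  have hc0 : ∀ j, 0 ≤ c j := fun j =>
    (norm_nonneg _).trans (hLc j u (by simpa using hu))
  have hint : ∀ m, Integrable (fun ω => Real.exp (u * cubeSum Y m ω)) μ := by
    intro m
    have := hind.integrable_exp_mul_sum (s := cube d m) hY (t := u)
      fun j _ => (hL j).mem_integrableExpSet hu
    simpa [cubeSum] using this
  have hbound : ∀ m, mgf (cubeSum Y m) μ u ≤ Real.exp (∑' j, c j) := by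
    intro m
    have h := congrArg norm (mgf_cubeSum hY hind hL m hu)
    rw [Complex.norm_real, Real.norm_eq_abs, abs_of_nonneg mgf_nonneg, Complex.norm_exp] at h
    rw [h]
    refine Real.exp_le_exp.2 ((Complex.re_le_norm _).trans ((norm_sum_le _ _).trans ?_))
    exact (Finset.sum_le_sum fun j _ => hLc j u (by simpa using hu)).trans
      (hc.sum_le_tsum _ fun j _ => hc0 j)
  refine ⟨(by fun_prop : AEMeasurable _ μ).aestronglyMeasurable, ?_⟩
  rw [hasFiniteIntegral_iff_ofReal (.of_forall fun _ => Real.exp_nonneg _)]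
  have hliminf : ∀ᵐ ω ∂μ, ENNReal.ofReal (Real.exp (u * T ω))
      = liminf (fun i => ENNReal.ofReal (Real.exp (u * cubeSum Y (ns i) ω))) atTop := by
    filter_upwards [hns] with ω hω
    have hcont : Continuous fun y : ℝ => ENNReal.ofReal (Real.exp (u * y)) :=
      ENNReal.continuous_ofReal.comp (by fun_prop)
    exact ((hcont.tendsto _).comp hω).liminf_eq.symm
  rw [lintegral_congr_ae hliminf]
  refine (lintegral_liminf_le fun i => ?_).trans_lt ?_
  · have := measurable_cubeSum hY (ns i)
    fun_prop
  · refine lt_of_le_of_lt (liminf_le_of_le (a := ENNReal.ofReal (Real.exp (∑' j, c j))) ?_ ?_)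
      ENNReal.ofReal_lt_top
    · isBoundedDefault
    · intro b hb
      obtain ⟨i, hi⟩ := hb.exists
      refine hi.trans ?_
      rw [← ofReal_integral_eq_lintegral_ofReal (hint _) (.of_forall fun _ => Real.exp_nonneg _)]
      exact ENNReal.ofReal_le_ofReal (hbound _)

lemma IsFieldSum.complexMGF_mul_I [IsProbabilityMeasure μ]
    (hT : IsFieldSum Y μ T) (hY : ∀ j, Measurable (Y j))
    (hind : iIndepFun Y μ) (hL : ∀ j, IsCGFOnDisc (Y j) μ r (L j))
    (hLc : ∀ j, ∀ z : ℂ, ‖z‖ < r → ‖L j z‖ ≤ c j) (hc : Summable c) {t : ℝ} (ht : |t| < r) :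
    complexMGF T μ (t * Complex.I) = Complex.exp (∑' j, L j (t * Complex.I)) := by
  have hTm := hT.aemeasurable hY
  rw [ProbabilityTheory.complexMGF_mul_I hTm]
  have hd := hT.tendstoInDistribution fun m => (measurable_cubeSum hY m).aemeasurable
  have hcf := ProbabilityMeasure.tendsto_iff_tendsto_charFun.1 hd.tendsto t
  refine tendsto_nhds_unique hcf ?_
  refine (tendsto_exp_sum_cube hLc hc (by simpa using ht)).congr fun m => ?_
  exact (charFun_map_cubeSum hY hind hL m ht).symm

lemma differentiableOn_tsum (hL : ∀ j, IsCGFOnDisc (Y j) μ r (L j))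
    (hLc : ∀ j, ∀ z : ℂ, ‖z‖ < r → ‖L j z‖ ≤ c j) (hc : Summable c) :
    DifferentiableOn ℂ (fun z => ∑' j, L j z) (Metric.ball 0 r) :=
  Complex.differentiableOn_tsum_of_summable_norm hc (fun j => (hL j).analytic.differentiableOn)
    Metric.isOpen_ball fun j z hz => hLc j z (by simpa using hz)

/-- Convergence in probability gives convergence of characteristic functions, hence equality on an
imaginary segment. Both sides are analytic in the disc, and the identity theorem does the rest. -/
lemma IsFieldSum.complexMGF_eq [IsProbabilityMeasure μ]
    (hT : IsFieldSum Y μ T) (hY : ∀ j, Measurable (Y j))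
    (hind : iIndepFun Y μ) (hr : 0 < r) (hL : ∀ j, IsCGFOnDisc (Y j) μ r (L j))
    (hLc : ∀ j, ∀ z : ℂ, ‖z‖ < r → ‖L j z‖ ≤ c j) (hc : Summable c) {z : ℂ} (hz : ‖z‖ < r) :
    complexMGF T μ z = Complex.exp (∑' j, L j z) := by
  have hf : AnalyticOnNhd ℂ (complexMGF T μ) (Metric.ball 0 r) := fun w hw => by
    refine analyticAt_complexMGF (mem_interior.2 ⟨Set.Ioo (-r) r, fun u hu =>
      hT.mem_integrableExpSet hY hind hL hLc hc (abs_lt.2 hu), isOpen_Ioo, abs_lt.1 ?_⟩)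
    exact (Complex.abs_re_le_norm w).trans_lt (by simpa using hw)
  have hg : AnalyticOnNhd ℂ (fun z => Complex.exp (∑' j, L j z)) (Metric.ball 0 r) :=
    (differentiableOn_tsum hL hLc hc).cexp.analyticOnNhd Metric.isOpen_ball
  refine hf.eqOn_of_preconnected_of_frequently_eq hg (convex_ball 0 r).isPreconnected
    (Metric.mem_ball_self hr) ?_ (by simpa using hz)
  have hline : Tendsto (fun t : ℝ => (t * Complex.I : ℂ)) (𝓝[>] 0) (𝓝[≠] 0) := by
    refine tendsto_nhdsWithin_iff.2 ⟨?_, ?_⟩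
    · have : Continuous fun t : ℝ => (t * Complex.I : ℂ) := by fun_prop
      have h0 := this.tendsto 0
      simp only [Complex.ofReal_zero, zero_mul] at h0
      exact h0.mono_left nhdsWithin_le_nhds
    · filter_upwards [self_mem_nhdsWithin] with t ht
      have ht : (0 : ℝ) < t := ht
      simp [ht.ne']
  refine hline.frequently (Eventually.frequently ?_)
  filter_upwards [self_mem_nhdsWithin, mem_nhdsWithin_of_mem_nhds (gt_mem_nhds hr)] with t h0 ht
  have h0 : (0 : ℝ) < t := h0
  exact hT.complexMGF_mul_I hY hind hL hLc hc (by rwa [abs_of_pos h0])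

end CGF

end FieldSum

/-! ### Application to the normalised sums -/

/-- The normalised field sum satisfies the hypotheses of the large deviation theorem. -/
lemma IsFieldSum.hasCubicRemainder {Ω : Type*} [MeasurableSpace Ω] {μ : Measure Ω}
    [IsProbabilityMeasure μ] {d : ℕ} {Y : (Fin d → ℤ) → Ω → ℝ} {T : Ω → ℝ} {r K : ℝ}
    {L : (Fin d → ℤ) → ℂ → ℂ} {c : (Fin d → ℤ) → ℝ} (hT : IsFieldSum Y μ T)
    (hY : ∀ j, Measurable (Y j)) (hmean : ∀ j, μ[Y j] = 0) (hind : iIndepFun Y μ) (hr : 0 < r)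
    (hvar : Summable fun j => Var[Y j; μ]) (hL : ∀ j, IsCGFOnDisc (Y j) μ r (L j))
    (hLc : ∀ j, ∀ z : ℂ, ‖z‖ < r → ‖L j z‖ ≤ c j) (hc : Summable c) (hK : 0 ≤ K)
    (hB : 0 < totalVar Y μ) (hcK : ∑' j, c j ≤ K * (totalVar Y μ * r ^ 2)) :
    HasCubicRemainder (fun ω => (√(totalVar Y μ))⁻¹ * T ω) μ
      (fun z => ∑' j, L j ((√(totalVar Y μ))⁻¹ * z : ℂ) - z ^ 2 / 2) K
      (r * √(totalVar Y μ) / 2) := by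
  set b := √(totalVar Y μ) with hb
  have hb0 : 0 < b := Real.sqrt_pos.2 hB
  have hb2 : b ^ 2 = totalVar Y μ := Real.sq_sqrt hB.le
  have hbc : (b : ℂ) ≠ 0 := by exact_mod_cast hb0.ne'
  have hTm := hT.aemeasurable hY
  -- The half in the radius keeps z/b within r/2, where the summands' cubic Taylor bound is valid.
  have hscale : ∀ z : ℂ, ‖z‖ < r * b / 2 → ‖(b⁻¹ * z : ℂ)‖ < r / 2 := by
    intro z hz
    rw [norm_mul, Complex.norm_real, norm_inv, Real.norm_eq_abs, abs_of_pos hb0,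
      inv_mul_lt_iff₀ hb0]
    linarith
  refine ⟨by fun_prop, by positivity, hK, fun u hu => ?_, ?_, fun z hz => ?_, fun z hz => ?_⟩
  · have hlt : |u * b⁻¹| < r := by
      have := hscale u (by simpa using hu)
      rw [← Complex.ofReal_mul, Complex.norm_real, Real.norm_eq_abs,
        mul_comm] at this
      linarith
    have := hT.mem_integrableExpSet hY hind hL hLc hc hlt
    simpa only [integrableExpSet, Set.mem_ofPred_eq, mul_assoc] using this
  · refine DifferentiableOn.sub ?_ (by fun_prop)
    refine (differentiableOn_tsum hL hLc hc).comp (by fun_prop) fun z hz => ?_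
    have := hscale z (by simpa using hz)
    rw [mem_ball_zero_iff]
    linarith
  · have hw := hscale z hz
    set w : ℂ := b⁻¹ * z with hw_def
    have hwr : ‖w‖ < r := by linarith
    have hsL : Summable fun j => L j w := hc.of_norm_bounded fun j => hLc j w hwr
    have hsv : HasSum (fun j => (Var[Y j; μ] : ℂ) * w ^ 2 / 2) (z ^ 2 / 2) := by
      have h1 : HasSum (fun j => (Var[Y j; μ] : ℂ)) (totalVar Y μ) :=
        Complex.hasSum_ofReal.2 hvar.hasSum
      have h2 := (h1.mul_right (w ^ 2)).div_const 2
      have hz2 : (totalVar Y μ : ℂ) * w ^ 2 = z ^ 2 := by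
        rw [← hb2, hw_def, mul_pow, Complex.ofReal_pow, Complex.ofReal_inv, inv_pow,
          mul_inv_cancel_left₀ (pow_ne_zero 2 hbc)]
      rwa [hz2] at h2
    have hsum := hsL.hasSum.sub hsv
    have hbound := hsum.norm_le_of_bounded ((hc.hasSum.mul_left 2).mul_right ((‖w‖ / r) ^ 3))
      fun j => (hL j).norm_sub_le hr (hY j).aemeasurable (hmean j) (hLc j) hw.le
    refine hbound.trans ?_
    calc 2 * (∑' j, c j) * (‖w‖ / r) ^ 3
        ≤ 2 * (K * (b ^ 2 * r ^ 2)) * (‖w‖ / r) ^ 3 := by rw [hb2]; gcongr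
      _ = K * ‖z‖ ^ 3 / (r * b / 2) := by
          rw [hw_def, norm_mul, Complex.norm_real, norm_inv, Real.norm_eq_abs, abs_of_pos hb0]
          field_simp
  · have hw := hscale z hz
    rw [add_sub_cancel, ← hT.complexMGF_eq hY hind hr hL hLc hc (by linarith)]
    simp only [complexMGF]
    congr 1 with ω
    push_cast
    ring_nf

lemma normCDF_eq {Ω : Type*} [MeasurableSpace Ω] {μ : Measure Ω} [IsProbabilityMeasure μ]
    {T : Ω → ℝ} (hT : AEMeasurable T μ) {b : ℝ} (hb : 0 < b) (x : ℝ) :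
    normCDF T μ b x = 1 - μ.real {ω | x ≤ (√b)⁻¹ * T ω} := by
  have hset : NullMeasurableSet {ω | x ≤ (√b)⁻¹ * T ω} μ :=
    nullMeasurableSet_le aemeasurable_const (hT.const_mul _)
  rw [normCDF, ← probReal_compl_eq_one_sub₀ hset]
  congr 1 with ω
  have hs : 0 < √b := Real.sqrt_pos.2 hb
  rw [Set.mem_compl_iff, Set.mem_ofPred_eq, Set.mem_ofPred_eq, not_le, inv_mul_lt_iff₀ hs, mul_comm]

end CramerField

theorem mainTheorem6 {Ω : Type*} [MeasurableSpace Ω] (μ : Measure Ω) [IsProbabilityMeasure μ]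
    (d : ℕ)
    -- the random field and its sums
    (X : ℕ → (Fin d → ℤ) → Ω → ℝ) (S : ℕ → Ω → ℝ)
    (hX_meas : ∀ n j, Measurable (X n j))
    (hX_mean : ∀ n j, μ[X n j] = 0)
    (hX_indep : ∀ n, iIndepFun (X n) μ)
    (hS : ∀ n, CramerField.IsFieldSum (X n) μ (S n))
    (hB : ∀ n, Summable (fun j => Var[X n j; μ]))
    -- Cramér's condition on the disc of radius `H n`
    (H : ℕ → ℝ) (hH : ∀ n, 0 < H n)
    (L : ℕ → (Fin d → ℤ) → ℂ → ℂ)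
    (hL : ∀ n j, CramerField.IsCGFOnDisc (X n j) μ (H n) (L n j))
    -- the bounds `c n j` on the cumulant generating functions
    (c : ℕ → (Fin d → ℤ) → ℝ) (hc_nonneg : ∀ n j, 0 ≤ c n j)
    (hLc : ∀ n j, ∀ z : ℂ, ‖z‖ < H n → ‖L n j z‖ ≤ c n j)
    (hBH : Tendsto (fun n => CramerField.totalVar (X n) μ * H n ^ 2) atTop atTop)
    (hc_summable : ∀ n, Summable (c n))
    (hC : (fun n => ∑' j, c n j) =O[atTop] fun n => CramerField.totalVar (X n) μ * H n ^ 2)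
    -- the points `x n`
    (x : ℕ → ℝ) (hx : Tendsto x atTop atTop)
    (hxo : x =o[atTop] fun n => H n * √(CramerField.totalVar (X n) μ))
    (a : ℝ) (ha : 0 < a) :
    Tendsto
      (fun n =>
        (CramerField.normCDF (S n) μ (CramerField.totalVar (X n) μ) (x n + a / x n)
            - CramerField.normCDF (S n) μ (CramerField.totalVar (X n) μ) (x n))
          / (1 - CramerField.normCDF (S n) μ (CramerField.totalVar (X n) μ) (x n)))
      atTop (𝓝 (1 - Real.exp (-a))) := by
  set B : ℕ → ℝ := fun n => CramerField.totalVar (X n) μ with hBdef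
  obtain ⟨K, hK, hCK⟩ := hC.exists_pos
  have hBpos : ∀ᶠ n in atTop, 0 < B n := by
    filter_upwards [hBH.eventually_gt_atTop 0] with n hn
    exact pos_of_mul_pos_left hn (sq_nonneg _)
  have hxD : Tendsto (fun n => x n / (H n * √(B n) / 2)) atTop (𝓝 0) := by
    have := hxo.tendsto_div_nhds_zero.mul_const 2
    rw [zero_mul] at this
    refine this.congr fun n => ?_
    rw [div_div_eq_mul_div, div_mul_eq_mul_div]
  -- These thresholds yield 4x < D and 64Kx ≤ D, as the saddle point requires. Since they hold only
  -- eventually, all sequences are shifted by N.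
  have hε : 0 < min (1 / 4) (1 / (64 * K)) := by positivity
  obtain ⟨N, hN⟩ := eventually_atTop.1 (hBpos.and (hCK.bound.and
    ((hx.eventually_gt_atTop 0).and (hxD.eventually_lt_const hε))))
  have hD : ∀ n, 0 < H (n + N) * √(B (n + N)) / 2 := fun n => by
    have := Real.sqrt_pos.2 (hN (n + N) (Nat.le_add_left _ _)).1
    have := hH (n + N)
    positivity
  have hR := fun n => (hS (n + N)).hasCubicRemainder (hX_meas _) (hX_mean _) (hX_indep _)
    (hH _) (hB _) (hL _) (hLc _) (hc_summable _) hK.le (hN (n + N) (Nat.le_add_left _ _)).1 (by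
      have h1 := (hN (n + N) (Nat.le_add_left _ _)).2.1
      have h2 := (hN (n + N) (Nat.le_add_left _ _)).1.le
      rw [Real.norm_eq_abs, Real.norm_eq_abs, abs_of_nonneg (a := B (n + N) * H (n + N) ^ 2)
        (by positivity)] at h1
      exact (le_abs_self _).trans h1)
  obtain ⟨hlim, hpos⟩ := CramerField.tendsto_measure_ratio hR
    (x := fun n => x (n + N)) ((tendsto_add_atTop_iff_nat N).2 hx)
    ((tendsto_add_atTop_iff_nat N).2 hxD) (fun n => (hN (n + N) (Nat.le_add_left _ _)).2.2.1)
    (fun n => by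
      have h := (hN (n + N) (Nat.le_add_left _ _)).2.2.2.trans_le (min_le_left _ _)
      rw [div_lt_iff₀ (hD n)] at h
      linarith)
    (fun n => by
      have h := (hN (n + N) (Nat.le_add_left _ _)).2.2.2.trans_le (min_le_right _ _)
      rw [div_lt_div_iff₀ (hD n) (by positivity)] at h
      linarith) a
  rw [← tendsto_add_atTop_iff_nat N]
  refine (hlim.const_sub 1).congr' ?_
  filter_upwards [hpos] with n hn
  have hBn := (hN (n + N) (Nat.le_add_left _ _)).1
  have hSm := (hS (n + N)).aemeasurable (hX_meas _)
  rw [CramerField.normCDF_eq hSm hBn, CramerField.normCDF_eq hSm hBn, sub_sub_cancel,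
    eq_div_iff hn.ne', sub_mul, div_mul_cancel₀ _ hn.ne']
  ring
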